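/- Let $I=[a,b]$ with $a<b$, and let $\tau>0$. A $C^{1+\tau}$ expanding cookie-cutter map on $I$ is a map $F:\bigcup_{i=1}^{q}I_i\to I$, where $q\ge 1$ and $I_1,\dots,I_q\subset I$ are pairwise disjoint closed intervals, such that every restriction $F|_{I_i}$ is a bijection onto $I$, is differentiable with $\tau$-Hölder derivative, and satisfies $|F'|>1$ on $I_i$. Let $f_i=(F|_{I_i})^{-1}:I\to I_i$. For a word $w=w_1\dots w_n\in\{1,\dots,q\}^n$ put $I_w=f_{w_1}\circ\dots\circ f_{w_n}(I)$, and for $s\in\mathbb{R}$ put \[ P_{n,F}(s)=\frac1n\log\sum_{w\in\{1,\dots,q\}^n}|I_w|^s,\qquad P_F(s)=\lim_{n\to\infty}P_{n,F}(s). \] Let $F_1,\dots,F_k$ be $C^{1+\tau}$ expanding cookie-cutter maps on $I$ and let $\overline{c}=(c_n)_{n\ge1}\in\{1,\dots,k\}^{\mathbb{N}}$ be a rarely switching sequence, that is, $\kappa_n:=\#\{m<n\mid c_m\ne c_{m+1}\}=o(n)$. Let \[ J_{\overline{c}}=\{x\in I\mid \forall n\ \ (F_{c_n}\circ\dots\circ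 F_{c_1})(x)\text{ is defined}\},\qquad \mathrm{Freq}_{n,j}=\frac{\#\{m\le n\mid c_m=j\}}{n}, \] and let $\Delta=\{\alpha\in\mathbb{R}^k\mid \alpha_j\ge0,\ \sum_j\alpha_j=1\}$. Then: 1. For all $j$ and all $s\in\mathbb{R}$, the limit defining $P_{F_j}(s)$ exists and is finite. 2. For every $\alpha\in\Delta$, the equation $\sum_{j=1}^k\alpha_jP_{F_j}(s)=0$ has exactly one solution $s\in\mathbb{R}$, denoted $\mathrm{Root}(\alpha)$, and it lies in $[0,1]$. The map $\mathrm{Root}:\Delta\to[0,1]$ is continuous. 3. The Hausdorff dimension and the upper box-counting dimension of $J_{\overline{c}}$ are \[ \dim_H J_{\overline{c}}=\liminf_{n\to\infty}\mathrm{Root}(\mathrm{Freq}_{n,1},\dots,\mathrm{Freq}_{n,k}),\qquad \overline{\dim}_B J_{\overline{c}}=\limsup_{n\to\infty}\mathrm{Root}(\mathrm{Freq}_{n,1},\dots,\mathrm{Freq}_{n,k}). \] -/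

import Mathlib

open Set Filter Topology
open scoped NNReal ENNReal

noncomputable section

/-- A cookie-cutter map of class `C^{1+τ}` on the closed interval `I = [a, b]`: pairwise disjoint
closed subintervals `I_i = [left i, right i]` of `I` (`i < q`) and a map defined on their union,
whose restriction to each `I_i` is a bijection onto `I`, is differentiable with `τ`-Hölder
derivative, and is expanding. One-sided derivatives are used at the endpoints of `I_i`.
The values of `toFun` outside the union of the `I_i` are irrelevant. -/
structure CookieCutter (a b : ℝ) (τ : ℝ≥0) where
  q : ℕ
  q_pos : 0 < q
  left : Fin q → ℝ
  right : Fin q → ℝ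
  left_lt_right : ∀ i, left i < right i
  subset : ∀ i, Icc (left i) (right i) ⊆ Icc a b
  disjoint : ∀ i j, i ≠ j → Disjoint (Icc (left i) (right i)) (Icc (left j) (right j))
  toFun : ℝ → ℝ
  bijOn : ∀ i, BijOn toFun (Icc (left i) (right i)) (Icc a b)
  differentiableOn : ∀ i, DifferentiableOn ℝ toFun (Icc (left i) (right i))
  holder : ∀ i, ∃ C : ℝ≥0, HolderOnWith C τ (derivWithin toFun (Icc (left i) (right i)))
    (Icc (left i) (right i))
  expanding : ∀ i, ∀ x ∈ Icc (left i) (right i),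
    1 < |derivWithin toFun (Icc (left i) (right i)) x|

namespace CookieCutter

variable {a b : ℝ} {τ : ℝ≥0}

/-- The subinterval `I_i`. -/
def piece (F : CookieCutter a b τ) (i : Fin F.q) : Set ℝ := Icc (F.left i) (F.right i)

/-- The domain of definition of the cookie-cutter map. -/
def domain (F : CookieCutter a b τ) : Set ℝ := ⋃ i, F.piece i

/-- The inverse branch `f_i : I → I_i` (relevant on `I = [a, b]` only). -/
def branch (F : CookieCutter a b τ) (i : Fin F.q) : ℝ → ℝ :=
  Function.invFunOn F.toFun (F.piece i)

/-- The interval `I_w = f_{w_1} ∘ ⋯ ∘ f_{w_n} (I)` of a word `w`. -/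
def cylinder (F : CookieCutter a b τ) : List (Fin F.q) → Set ℝ
  | [] => Icc a b
  | i :: w => F.branch i '' F.cylinder w

/-- The partition function `Z_n(s)`, the sum of `|I_w|^s` over all words `w` of length `n`. -/
def partitionFn (F : CookieCutter a b τ) (n : ℕ) (s : ℝ) : ℝ :=
  ∑ w : Fin n → Fin F.q, Metric.diam (F.cylinder (List.ofFn w)) ^ s

/-- The `n`-iterates pressure function `P_n(s) = (1/n) log Z_n(s)`. -/
def pressureN (F : CookieCutter a b τ) (n : ℕ) (s : ℝ) : ℝ :=
  1 / (n : ℝ) * Real.log (F.partitionFn n s)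

/-- The stationary pressure function, the limit of `P_n(s)` as `n → ∞`. -/
def pressure (F : CookieCutter a b τ) (s : ℝ) : ℝ :=
  limUnder atTop (fun n : ℕ => F.pressureN n s)

variable {k : ℕ}

/-- The non-stationary orbit `(F_{c_n} ∘ ⋯ ∘ F_{c_1})(x)`, where `c_1 = c 0`, `c_2 = c 1`, and so
on. It is meaningful as long as all the previous points lie in the respective domains. -/
def orbit (F : Fin k → CookieCutter a b τ) (c : ℕ → Fin k) (x : ℝ) : ℕ → ℝ
  | 0 => x
  | n + 1 => (F (c n)).toFun (orbit F c x n)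

/-- The cookie-cutter-like set `J(F; c)`: the points of `I` at which all the compositions
`F_{c_n} ∘ ⋯ ∘ F_{c_1}` are defined. -/
def limitSet (F : Fin k → CookieCutter a b τ) (c : ℕ → Fin k) : Set ℝ :=
  {x | x ∈ Icc a b ∧ ∀ n, orbit F c x n ∈ (F (c n)).domain}

/-- `Root(α)`: the zero in `[0, 1]` of the linear combination of pressures `∑ α_j P_{F_j}`. -/
def root (F : Fin k → CookieCutter a b τ) (α : Fin k → ℝ) : ℝ :=
  Classical.epsilon fun s : ℝ => s ∈ Icc (0 : ℝ) 1 ∧ ∑ j, α j * (F j).pressure s = 0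

end CookieCutter

/-- The number of switches `κ_n = #{1 ≤ m < n | c_m ≠ c_{m+1}}`, where `c_m` is `c (m - 1)`. -/
def switchCount {k : ℕ} (c : ℕ → Fin k) (n : ℕ) : ℕ :=
  ((Finset.range (n - 1)).filter fun m => c m ≠ c (m + 1)).card

/-- The sequence switches rarely: `κ_n = o(n)`. -/
def RarelySwitching {k : ℕ} (c : ℕ → Fin k) : Prop :=
  (fun n : ℕ => (switchCount c n : ℝ)) =o[atTop] (fun n : ℕ => (n : ℝ))

/-- The frequency `Freq_{n,j} = #{1 ≤ m ≤ n | c_m = j} / n`, where `c_m` is `c (m - 1)`. -/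
def freq {k : ℕ} (c : ℕ → Fin k) (n : ℕ) (j : Fin k) : ℝ :=
  (((Finset.range n).filter fun m => c m = j).card : ℝ) / (n : ℝ)

/-- The upper box-counting dimension of a set: the upper limit as `ε → 0+` of
`log N(ε) / log (1/ε)`, where `N(ε)` is the least number of closed `ε`-balls covering the set. -/
def upperBoxDim {X : Type*} [PseudoEMetricSpace X] (A : Set X) : EReal :=
  limsup (fun ε : ℝ≥0 => ENNReal.log ((Metric.externalCoveringNumber ε A : ℕ∞) : ℝ≥0∞) /
    ((-Real.log (ε : ℝ) : ℝ) : EReal)) (𝓝[>] 0)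

end

/-! Bounded distortion makes cylinder lengths multiplicative up to a constant `B` under
concatenation, even for words that mix the maps. Hence log Z_n(s), with Z_n(s) = `partSum F c n s`,
is additive up to an error |s| log B that does not depend on the sequence. On a block where c is
constant it equals the block length times the pressure up to a bounded error, so log Z_n(s) differs
from the sum of the pressures along c by O(κ_n + 1) = o(n) (`exists_abs_error_le`). All pressures
decrease at rate at least -log ρ > 0; therefore Z_n(s) decays exponentially when s exceeds
Root(Freq_n) by a fixed margin, and grows exponentially when s stays below it by a fixed margin.

The dimensions are read off from Z_n. If Z_n(s) ≤ 1 for infinitely many n, the cylinders of those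
levels are efficient covers and dim_H ≤ s (`dimH_limitSet_le`). If Z_n(s) is bounded below, refining
a finite cover by cylinders to a common level bounds its s-sum from below, and the gaps between
cylinders reduce arbitrary covers to such covers (`le_dimH_limitSet`). For boxes, cylinders of size
about ε bound the covering number by a constant times ε^(-s) ∑ Z_n(s) (`externalCoveringNumber_le`);
conversely, separation of cylinders turns a covering bound ε^(-t) into a bound on Z_n(s) for s > t
(`exists_partSum_le_of_covering_le`). The first pair produces the liminf, the second the limsup. -/

namespace CookieCutter

/-! ### A single map: inverse branches, mean value theorem, compactness. -/

section SingleMap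

variable {a b : ℝ} {τ : ℝ≥0} (F : CookieCutter a b τ)

/-- The derivative of a cookie-cutter map on the piece `I_i` (one-sided at the endpoints). -/
noncomputable def slope (i : Fin F.q) : ℝ → ℝ := derivWithin F.toFun (F.piece i)

lemma branch_mem (i : Fin F.q) {x : ℝ} (hx : x ∈ Icc a b) : F.branch i x ∈ F.piece i :=
  Function.invFunOn_mem ((F.bijOn i).surjOn hx)

lemma toFun_branch (i : Fin F.q) {x : ℝ} (hx : x ∈ Icc a b) : F.toFun (F.branch i x) = x :=
  Function.invFunOn_eq ((F.bijOn i).surjOn hx)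

lemma branch_toFun (i : Fin F.q) {x : ℝ} (hx : x ∈ F.piece i) :
    F.branch i (F.toFun x) = x := by
  have h := (F.bijOn i).mapsTo hx
  exact (F.bijOn i).injOn (F.branch_mem i h) hx (F.toFun_branch i h)

lemma branch_mem_Icc (i : Fin F.q) {x : ℝ} (hx : x ∈ Icc a b) : F.branch i x ∈ Icc a b :=
  F.subset i (F.branch_mem i hx)

lemma piece_eq_image (i : Fin F.q) : F.piece i = F.branch i '' Icc a b := by
  ext x
  constructor
  · intro hx
    exact ⟨F.toFun x, (F.bijOn i).mapsTo hx, F.branch_toFun i hx⟩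
  · rintro ⟨y, hy, rfl⟩
    exact F.branch_mem i hy

lemma index_unique {i i' : Fin F.q} {x : ℝ} (h : x ∈ F.piece i) (h' : x ∈ F.piece i') :
    i = i' := by
  by_contra hne
  exact Set.disjoint_left.1 (F.disjoint i i' hne) h h'

/-- Mean value theorem. The point comes from the open interval, where the one-sided derivative
`slope` is a genuine derivative. Absolute values appear because branches may reverse orientation. -/
lemma exists_slope_of_lt (i : Fin F.q) {x y : ℝ} (hx : x ∈ F.piece i) (hy : y ∈ F.piece i)
    (hxy : x < y) :
    ∃ ξ ∈ Icc x y, |F.toFun x - F.toFun y| = |F.slope i ξ| * |x - y| := by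
  have hsub : Icc x y ⊆ F.piece i := Icc_subset_Icc hx.1 hy.2
  have hnhds : ∀ z ∈ Ioo x y, F.piece i ∈ 𝓝 z := fun z hz =>
    mem_of_superset (Icc_mem_nhds hz.1 hz.2) hsub
  obtain ⟨ξ, hξ, h⟩ := exists_deriv_eq_slope F.toFun hxy
    ((F.differentiableOn i).continuousOn.mono hsub)
    (fun z hz => ((F.differentiableOn i).differentiableAt
      (hnhds z hz)).differentiableWithinAt)
  refine ⟨ξ, Ioo_subset_Icc_self hξ, ?_⟩
  rw [slope, derivWithin_of_mem_nhds (hnhds ξ hξ), h, abs_div, abs_sub_comm x y,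
    abs_sub_comm (F.toFun x)]
  have : |y - x| ≠ 0 := abs_ne_zero.2 (sub_ne_zero.2 hxy.ne')
  field_simp

lemma exists_slope (i : Fin F.q) {x y : ℝ} (hx : x ∈ F.piece i) (hy : y ∈ F.piece i) :
    ∃ ξ ∈ uIcc x y, |F.toFun x - F.toFun y| = |F.slope i ξ| * |x - y| := by
  rcases lt_trichotomy x y with h | rfl | h
  · rw [uIcc_of_le h.le]
    exact F.exists_slope_of_lt i hx hy h
  · exact ⟨x, by simp, by simp⟩
  · rw [uIcc_of_ge h.le, abs_sub_comm, abs_sub_comm x]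
    exact F.exists_slope_of_lt i hy hx h

lemma piece_ordConnected (i : Fin F.q) : (F.piece i).OrdConnected := ordConnected_Icc

lemma isCompact_piece (i : Fin F.q) : IsCompact (F.piece i) := isCompact_Icc

lemma continuousOn_slope (hτ : 0 < τ) (i : Fin F.q) : ContinuousOn (F.slope i) (F.piece i) := by
  obtain ⟨C, hC⟩ := F.holder i
  exact hC.continuousOn hτ

/-- Compactness upgrades |F'| > 1 to a uniform margin. The margin is an element of `Ioi 0` so that
`Finite.exists_ge` can later extract a common positive bound, even from an empty family. -/
lemma exists_lt_abs_slope (hτ : 0 < τ) (i : Fin F.q) :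
    ∃ t : Ioi (0 : ℝ), ∀ x ∈ F.piece i, 1 + (t : ℝ) ≤ |F.slope i x| := by
  obtain ⟨x₀, hx₀, h⟩ := (F.isCompact_piece i).exists_isMinOn
    ⟨F.left i, left_mem_Icc.2 (F.left_lt_right i).le⟩ (F.continuousOn_slope hτ i).abs
  refine ⟨⟨|F.slope i x₀| - 1, sub_pos.2 (F.expanding i x₀ hx₀)⟩, fun x hx => ?_⟩
  have := h hx
  simp only [mem_ofPred_eq] at this
  linarith

lemma exists_pos_le_dist_pieces (i i' : Fin F.q) (h : i ≠ i') :
    ∃ t : Ioi (0 : ℝ), ∀ x ∈ F.piece i, ∀ y ∈ F.piece i', (t : ℝ) ≤ |x - y| := by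
  obtain ⟨p, hp, hmin⟩ := ((F.isCompact_piece i).prod (F.isCompact_piece i')).exists_isMinOn
    ⟨(F.left i, F.left i'), left_mem_Icc.2 (F.left_lt_right i).le,
      left_mem_Icc.2 (F.left_lt_right i').le⟩
    (f := fun p : ℝ × ℝ => |p.1 - p.2|) (by fun_prop)
  refine ⟨⟨|p.1 - p.2|, mem_Ioi.2 (abs_pos.2 (sub_ne_zero.2 fun he => ?_))⟩, fun x hx y hy => ?_⟩
  · exact h (F.index_unique hp.1 (he ▸ hp.2))
  · exact hmin (mk_mem_prod hx hy)

end SingleMap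

/-! ### Words in several maps and bounded distortion. -/

section Family

variable {a b : ℝ} {τ : ℝ≥0} {k : ℕ} (F : Fin k → CookieCutter a b τ)

/-- The letters of the words of a family of cookie-cutter maps: a map together with one of its
inverse branches. -/
abbrev Letter := Σ j, Fin (F j).q

/-- The composition of inverse branches along a word. -/
noncomputable def wordMap : List (Letter F) → ℝ → ℝ
  | [] => id
  | l :: w => fun x => (F l.1).branch l.2 (wordMap w x)

/-- The interval `I_w` of a word in the inverse branches of several maps. -/
def cyl (w : List (Letter F)) : Set ℝ := wordMap F w '' Icc a b

/-- The length of the interval `I_w`. -/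
noncomputable def len (w : List (Letter F)) : ℝ := Metric.diam (cyl F w)

@[simp] lemma wordMap_nil (x : ℝ) : wordMap F [] x = x := rfl

@[simp] lemma wordMap_cons (l : Letter F) (w : List (Letter F)) (x : ℝ) :
    wordMap F (l :: w) x = (F l.1).branch l.2 (wordMap F w x) := rfl

lemma wordMap_append (u v : List (Letter F)) (x : ℝ) :
    wordMap F (u ++ v) x = wordMap F u (wordMap F v x) := by
  induction u with
  | nil => rfl
  | cons l u ih => simp [ih]

@[simp] lemma cyl_nil : cyl F [] = Icc a b := by simp [cyl, wordMap]

lemma cyl_append (u v : List (Letter F)) : cyl F (u ++ v) = wordMap F u '' cyl F v := by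
  rw [cyl, cyl, image_image]
  exact image_congr fun x _ => wordMap_append F u v x

lemma cyl_cons (l : Letter F) (w : List (Letter F)) :
    cyl F (l :: w) = (F l.1).branch l.2 '' cyl F w := by
  rw [cyl, cyl, image_image]
  rfl

lemma wordMap_mem (w : List (Letter F)) {x : ℝ} (hx : x ∈ Icc a b) :
    wordMap F w x ∈ Icc a b := by
  induction w with
  | nil => exact hx
  | cons l w ih => exact (F l.1).branch_mem_Icc l.2 ih

lemma cyl_subset (w : List (Letter F)) : cyl F w ⊆ Icc a b := by
  rintro _ ⟨x, hx, rfl⟩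
  exact wordMap_mem F w hx

lemma cyl_append_subset (u v : List (Letter F)) : cyl F (u ++ v) ⊆ cyl F u := by
  rw [cyl_append]
  exact image_mono (cyl_subset F v)

lemma cyl_cons_subset_piece (l : Letter F) (w : List (Letter F)) :
    cyl F (l :: w) ⊆ (F l.1).piece l.2 := by
  rw [piece_eq_image, cyl_cons]
  exact image_mono (cyl_subset F w)

lemma isBounded_cyl (w : List (Letter F)) : Bornology.IsBounded (cyl F w) :=
  (Metric.isBounded_Icc a b).subset (cyl_subset F w)

lemma exists_uniform_slope (hτ : 0 < τ) :
    ∃ t : ℝ, 0 < t ∧ ∀ j (i : Fin (F j).q), ∀ x ∈ (F j).piece i, 1 + t ≤ |(F j).slope i x| := by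
  choose t ht using fun l : Letter F => (F l.1).exists_lt_abs_slope hτ l.2
  obtain ⟨m, hm⟩ := Finite.exists_ge t
  exact ⟨m, m.2, fun j i x hx => le_trans (by
    have : (m : ℝ) ≤ t ⟨j, i⟩ := hm ⟨j, i⟩
    linarith) (ht ⟨j, i⟩ x hx)⟩

lemma exists_uniform_gap :
    ∃ t : ℝ, 0 < t ∧ ∀ j (i i' : Fin (F j).q), i ≠ i' → ∀ x ∈ (F j).piece i,
      ∀ y ∈ (F j).piece i', t ≤ |x - y| := by
  choose t ht using fun l : {p : Σ j, Fin (F j).q × Fin (F j).q // p.2.1 ≠ p.2.2} =>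
    (F l.1.1).exists_pos_le_dist_pieces l.1.2.1 l.1.2.2 l.2
  obtain ⟨m, hm⟩ := Finite.exists_ge t
  refine ⟨m, m.2, fun j i i' h x hx y hy => ?_⟩
  have : (m : ℝ) ≤ t ⟨⟨j, i, i'⟩, h⟩ := hm _
  exact this.trans (ht ⟨⟨j, i, i'⟩, h⟩ x hx y hy)

lemma exists_uniform_holder :
    ∃ H : ℝ, 0 ≤ H ∧ ∀ j (i : Fin (F j).q), ∀ x ∈ (F j).piece i, ∀ y ∈ (F j).piece i,
      |(F j).slope i x - (F j).slope i y| ≤ H * |x - y| ^ (τ : ℝ) := by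
  choose C hC using fun l : Letter F => (F l.1).holder l.2
  obtain ⟨M, hM⟩ := Finite.exists_le C
  refine ⟨M, M.2, fun j i x hx y hy => ?_⟩
  have h := (hC ⟨j, i⟩).dist_le hx hy
  simp only [Real.dist_eq] at h
  refine h.trans (mul_le_mul_of_nonneg_right ?_ (by positivity))
  exact_mod_cast hM ⟨j, i⟩

lemma branch_contracting {ρ : ℝ} (hρ : 0 < ρ)
    (h : ∀ j (i : Fin (F j).q), ∀ x ∈ (F j).piece i, ρ⁻¹ ≤ |(F j).slope i x|)
    (l : Letter F) {x y : ℝ} (hx : x ∈ Icc a b) (hy : y ∈ Icc a b) :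
    |(F l.1).branch l.2 x - (F l.1).branch l.2 y| ≤ ρ * |x - y| := by
  obtain ⟨ξ, hξ, he⟩ := (F l.1).exists_slope l.2 ((F l.1).branch_mem l.2 hx)
    ((F l.1).branch_mem l.2 hy)
  rw [toFun_branch _ _ hx, toFun_branch _ _ hy] at he
  rw [he, ← mul_assoc]
  have h1 := h l.1 l.2 ξ (((F l.1).piece_ordConnected l.2).uIcc_subset
    ((F l.1).branch_mem l.2 hx) ((F l.1).branch_mem l.2 hy) hξ)
  have : 1 ≤ ρ * |(F l.1).slope l.2 ξ| := by
    calc 1 = ρ * ρ⁻¹ := (mul_inv_cancel₀ hρ.ne').symm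
      _ ≤ _ := by gcongr
  exact le_mul_of_one_le_left (abs_nonneg _) this

lemma wordMap_contracting {ρ : ℝ} (hρ : 0 < ρ)
    (h : ∀ j (i : Fin (F j).q), ∀ x ∈ (F j).piece i, ρ⁻¹ ≤ |(F j).slope i x|)
    (w : List (Letter F)) {x y : ℝ} (hx : x ∈ Icc a b) (hy : y ∈ Icc a b) :
    |wordMap F w x - wordMap F w y| ≤ ρ ^ w.length * |x - y| := by
  induction w with
  | nil => simp
  | cons l w ih =>
    simp only [wordMap_cons, List.length_cons]
    refine (branch_contracting F hρ h l (wordMap_mem F w hx) (wordMap_mem F w hy)).trans ?_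
    rw [pow_succ', mul_assoc]
    gcongr

lemma continuousOn_wordMap {ρ : ℝ} (hρ : 0 < ρ)
    (h : ∀ j (i : Fin (F j).q), ∀ x ∈ (F j).piece i, ρ⁻¹ ≤ |(F j).slope i x|)
    (w : List (Letter F)) : ContinuousOn (wordMap F w) (Icc a b) := by
  have : LipschitzOnWith ⟨ρ ^ w.length, by positivity⟩ (wordMap F w) (Icc a b) :=
    LipschitzOnWith.of_dist_le_mul fun x hx y hy => wordMap_contracting F hρ h w hx hy
  exact this.continuousOn

lemma abs_sub_le_of_mem_cyl {ρ : ℝ} (hρ : 0 < ρ)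
    (h : ∀ j (i : Fin (F j).q), ∀ x ∈ (F j).piece i, ρ⁻¹ ≤ |(F j).slope i x|)
    (w : List (Letter F)) {x y : ℝ} (hx : x ∈ cyl F w) (hy : y ∈ cyl F w) :
    |x - y| ≤ ρ ^ w.length * (b - a) := by
  obtain ⟨x, hx, rfl⟩ := hx
  obtain ⟨y, hy, rfl⟩ := hy
  refine (wordMap_contracting F hρ h w hx hy).trans ?_
  gcongr
  rw [abs_le]
  constructor <;> linarith [hx.1, hx.2, hy.1, hy.2]

lemma ordConnected_cyl {ρ : ℝ} (hρ : 0 < ρ)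
    (h : ∀ j (i : Fin (F j).q), ∀ x ∈ (F j).piece i, ρ⁻¹ ≤ |(F j).slope i x|)
    (w : List (Letter F)) : (cyl F w).OrdConnected :=
  (isPreconnected_Icc.image _ (continuousOn_wordMap F hρ h w)).ordConnected

/-- Points of a common cylinder are exponentially close, so the Hölder condition bounds the
difference of slopes by E. Since slopes are at least 1 in absolute value, this additive error is a
factor 1 + E ≤ exp E. -/
lemma slope_ratio_le {ρ H : ℝ} (hρ : 0 < ρ) (hρ1 : ρ < 1) (hH : 0 ≤ H)
    (h : ∀ j (i : Fin (F j).q), ∀ x ∈ (F j).piece i, ρ⁻¹ ≤ |(F j).slope i x|)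
    (hhol : ∀ j (i : Fin (F j).q), ∀ x ∈ (F j).piece i, ∀ y ∈ (F j).piece i,
      |(F j).slope i x - (F j).slope i y| ≤ H * |x - y| ^ (τ : ℝ))
    (l : Letter F) (w : List (Letter F)) {ξ η : ℝ} (hξ : ξ ∈ cyl F (l :: w))
    (hη : η ∈ cyl F (l :: w)) :
    |(F l.1).slope l.2 η| ≤ Real.exp (H * (b - a) ^ (τ : ℝ) * (ρ ^ (τ : ℝ)) ^ (w.length + 1)) *
      |(F l.1).slope l.2 ξ| := by
  have hξp := cyl_cons_subset_piece F l w hξ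
  have hηp := cyl_cons_subset_piece F l w hη
  have hab : 0 ≤ b - a := by
    have := cyl_subset F _ hξ
    linarith [this.1, this.2]
  have h1 : 1 ≤ |(F l.1).slope l.2 ξ| :=
    (one_lt_inv₀ hρ |>.2 hρ1).le.trans (h l.1 l.2 ξ hξp)
  have h2 := abs_sub_le_of_mem_cyl F hρ h (l :: w) hη hξ
  rw [List.length_cons] at h2
  have h3 : |η - ξ| ^ (τ : ℝ) ≤ (b - a) ^ (τ : ℝ) * (ρ ^ (τ : ℝ)) ^ (w.length + 1) := by
    calc |η - ξ| ^ (τ : ℝ) ≤ (ρ ^ (w.length + 1) * (b - a)) ^ (τ : ℝ) := by gcongr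
      _ = _ := by
        rw [Real.mul_rpow (by positivity) hab, mul_comm, ← Real.rpow_natCast,
          ← Real.rpow_mul hρ.le, mul_comm _ (τ : ℝ), Real.rpow_mul hρ.le, Real.rpow_natCast]
  have h4 := hhol l.1 l.2 η hηp ξ hξp
  set E := H * (b - a) ^ (τ : ℝ) * (ρ ^ (τ : ℝ)) ^ (w.length + 1) with hE
  have hE0 : 0 ≤ E := by positivity
  have h5 : |(F l.1).slope l.2 η - (F l.1).slope l.2 ξ| ≤ E := by
    refine h4.trans ?_
    rw [hE, mul_assoc]
    gcongr
  calc |(F l.1).slope l.2 η| ≤ |(F l.1).slope l.2 ξ| + E := by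
        have := abs_sub_abs_le_abs_sub ((F l.1).slope l.2 η) ((F l.1).slope l.2 ξ)
        linarith
    _ ≤ (E + 1) * |(F l.1).slope l.2 ξ| := by nlinarith
    _ ≤ _ := by
      gcongr
      exact Real.add_one_le_exp E

/-- Bounded distortion, with an explicit constant for words of a given length. -/
lemma distortion_aux {ρ H : ℝ} (hρ : 0 < ρ) (hρ1 : ρ < 1) (hH : 0 ≤ H)
    (h : ∀ j (i : Fin (F j).q), ∀ x ∈ (F j).piece i, ρ⁻¹ ≤ |(F j).slope i x|)
    (hhol : ∀ j (i : Fin (F j).q), ∀ x ∈ (F j).piece i, ∀ y ∈ (F j).piece i,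
      |(F j).slope i x - (F j).slope i y| ≤ H * |x - y| ^ (τ : ℝ))
    (w : List (Letter F)) {x y z t : ℝ} (hx : x ∈ Icc a b) (hy : y ∈ Icc a b)
    (hz : z ∈ Icc a b) (ht : t ∈ Icc a b) :
    |wordMap F w x - wordMap F w y| * |z - t| ≤
      Real.exp (H * (b - a) ^ (τ : ℝ) * ∑ m ∈ Finset.range w.length, (ρ ^ (τ : ℝ)) ^ (m + 1)) *
        (|wordMap F w z - wordMap F w t| * |x - y|) := by
  induction w with
  | nil => simp [mul_comm]
  | cons l w ih =>
    -- The mean value theorem peels off the outermost branch. Order connectedness keeps the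
    -- intermediate point in the cylinder of `l :: w`, so the two slopes obtained are comparable by
    -- `slope_ratio_le`.
    have key : ∀ {x y : ℝ}, x ∈ Icc a b → y ∈ Icc a b → ∃ ξ ∈ cyl F (l :: w),
        |wordMap F w x - wordMap F w y| = |(F l.1).slope l.2 ξ| *
          |wordMap F (l :: w) x - wordMap F (l :: w) y| := by
      intro x y hx hy
      have hx' := wordMap_mem F w hx
      have hy' := wordMap_mem F w hy
      obtain ⟨ξ, hξ, he⟩ := (F l.1).exists_slope l.2 ((F l.1).branch_mem l.2 hx')
        ((F l.1).branch_mem l.2 hy')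
      rw [toFun_branch _ _ hx', toFun_branch _ _ hy'] at he
      exact ⟨ξ, (ordConnected_cyl F hρ h (l :: w)).uIcc_subset (mem_image_of_mem _ hx)
        (mem_image_of_mem _ hy) hξ, he⟩
    obtain ⟨ξ, hξ, hxy⟩ := key hx hy
    obtain ⟨η, hη, hzt⟩ := key hz ht
    have hr := slope_ratio_le F hρ hρ1 hH h hhol l w hξ hη
    rw [hxy, hzt] at ih
    rw [List.length_cons, Finset.sum_range_succ, mul_add, Real.exp_add]
    set S := Real.exp (H * (b - a) ^ (τ : ℝ) *
      ∑ m ∈ Finset.range w.length, (ρ ^ (τ : ℝ)) ^ (m + 1))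
    set E := Real.exp (H * (b - a) ^ (τ : ℝ) * (ρ ^ (τ : ℝ)) ^ (w.length + 1))
    have hpos : 0 < |(F l.1).slope l.2 ξ| :=
      (inv_pos.2 hρ).trans_le (h _ _ _ (cyl_cons_subset_piece F l w hξ))
    refine le_of_mul_le_mul_left ?_ hpos
    calc _ = |(F l.1).slope l.2 ξ| * |wordMap F (l :: w) x - wordMap F (l :: w) y| * |z - t| := by
          ring
      _ ≤ _ := ih
      _ ≤ S * (E * |(F l.1).slope l.2 ξ| * |wordMap F (l :: w) z - wordMap F (l :: w) t| *
            |x - y|) := by gcongr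
      _ = _ := by ring

end Family

end CookieCutter

/-! ### Uniform geometric constants. -/

namespace CookieCutter

variable {a b : ℝ} {τ : ℝ≥0} {k : ℕ}

/-- Uniform geometric constants of a family of cookie-cutter maps: contraction ratio `ρ`,
quasi-multiplicativity constant `B`, and lower bounds `θ` and `δ` for the relative size of the
children of a cylinder and of the gaps between them. -/
structure Geometry (F : Fin k → CookieCutter a b τ) where
  ρ : ℝ
  B : ℝ
  θ : ℝ
  δ : ℝ
  hab : a < b
  ρ_pos : 0 < ρ
  ρ_lt_one : ρ < 1
  one_le_B : 1 ≤ B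
  θ_pos : 0 < θ
  θ_lt_one : θ < 1
  δ_pos : 0 < δ
  isCompact_cyl : ∀ w, IsCompact (cyl F w)
  ordConnected_cyl : ∀ w, (cyl F w).OrdConnected
  len_pos : ∀ w, 0 < len F w
  len_le : ∀ w, len F w ≤ ρ ^ w.length * (b - a)
  mul_le_len_append : ∀ u v, len F u * len F v ≤ B * len F (u ++ v)
  len_append_le : ∀ u v, len F (u ++ v) ≤ B * (len F u * len F v)
  child : ∀ u l, θ * len F u ≤ len F (u ++ [l])
  gap : ∀ u j i i' v v', i ≠ i' → ∀ x ∈ cyl F (u ++ ⟨j, i⟩ :: v),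
    ∀ y ∈ cyl F (u ++ ⟨j, i'⟩ :: v'), δ * len F u ≤ |x - y|

variable (F : Fin k → CookieCutter a b τ)

lemma wordMap_injOn_Icc (w : List (Letter F)) : InjOn (wordMap F w) (Icc a b) := by
  induction w with
  | nil => exact injOn_id _
  | cons l w ih =>
    intro x hx y hy h
    refine ih hx hy ?_
    have := congrArg (F l.1).toFun h
    simpa [toFun_branch _ _ (wordMap_mem F w hx), toFun_branch _ _ (wordMap_mem F w hy)] using this

/-- The diameter is attained by compactness, so monotonicity of the branches plays no role. -/
lemma exists_len_eq (hab : a < b) (w : List (Letter F)) (hc : IsCompact (cyl F w)) :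
    ∃ x ∈ Icc a b, ∃ y ∈ Icc a b, len F w = |wordMap F w x - wordMap F w y| := by
  have hne : (cyl F w).Nonempty := ⟨_, mem_image_of_mem _ (left_mem_Icc.2 hab.le)⟩
  obtain ⟨p, hp, hmax⟩ := (hc.prod hc).exists_isMaxOn (hne.prod hne)
    (f := fun p : ℝ × ℝ => |p.1 - p.2|) (by fun_prop)
  obtain ⟨⟨x, hx, hx'⟩, ⟨y, hy, hy'⟩⟩ := hp
  refine ⟨x, hx, y, hy, ?_⟩
  rw [hx', hy']
  refine le_antisymm (Metric.diam_le_of_forall_dist_le (abs_nonneg _) fun p hp q hq => ?_) ?_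
  · exact hmax (mk_mem_prod hp hq)
  · rw [← Real.dist_eq, ← hx', ← hy']
    exact Metric.dist_le_diam_of_mem (isBounded_cyl F w) (mem_image_of_mem _ hx)
      (mem_image_of_mem _ hy)

variable {F} in
lemma abs_sub_le_len {w : List (Letter F)} {x y : ℝ} (hx : x ∈ cyl F w) (hy : y ∈ cyl F w) :
    |x - y| ≤ len F w := by
  rw [← Real.dist_eq]
  exact Metric.dist_le_diam_of_mem (isBounded_cyl F w) hx hy

theorem exists_distortion (hab : a < b) (hτ : 0 < τ) :
    ∃ ρ C : ℝ, 0 < ρ ∧ ρ < 1 ∧ 1 ≤ C ∧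
      (∀ j (i : Fin (F j).q), ∀ x ∈ (F j).piece i, ρ⁻¹ ≤ |(F j).slope i x|) ∧
      ∀ w, ∀ x ∈ Icc a b, ∀ y ∈ Icc a b, ∀ z ∈ Icc a b, ∀ t ∈ Icc a b,
        |wordMap F w x - wordMap F w y| * |z - t| ≤
          C * (|wordMap F w z - wordMap F w t| * |x - y|) := by
  obtain ⟨s, hs, hsl⟩ := exists_uniform_slope F hτ
  obtain ⟨H, hH, hhol⟩ := exists_uniform_holder F
  set ρ := (1 + s)⁻¹ with hρd
  have hρ : 0 < ρ := by positivity
  have hρ1 : ρ < 1 := inv_lt_one_of_one_lt₀ (by linarith)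
  have hsl' : ∀ j (i : Fin (F j).q), ∀ x ∈ (F j).piece i, ρ⁻¹ ≤ |(F j).slope i x| := by
    simpa [hρd] using hsl
  have hba : 0 < b - a := sub_pos.2 hab
  have hτ' : (0 : ℝ) < τ := hτ
  set σ := ρ ^ (τ : ℝ) with hσ
  have hσ0 : 0 < σ := by positivity
  have hσ1 : σ < 1 := Real.rpow_lt_one hρ.le hρ1 hτ'
  refine ⟨ρ, Real.exp (H * (b - a) ^ (τ : ℝ) * (1 - σ)⁻¹), hρ, hρ1, ?_, hsl',
    fun w x hx y hy z hz t ht => ?_⟩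
  · rw [Real.one_le_exp_iff]
    have : 0 < (1 - σ)⁻¹ := inv_pos.2 (by linarith)
    positivity
  · refine (distortion_aux F hρ hρ1 hH hsl' hhol w hx hy hz ht).trans ?_
    gcongr
    rw [← tsum_geometric_of_lt_one hσ0.le hσ1]
    -- The exponents m + 1 are lowered to m, and the geometric series bounds the distortion
    -- independently of the word length.
    refine le_trans ?_ ((summable_geometric_of_lt_one hσ0.le hσ1).sum_le_tsum
      (Finset.range w.length) fun _ _ => by positivity)
    exact Finset.sum_le_sum fun m _ => pow_le_pow_of_le_one hσ0.le hσ1.le (Nat.le_succ m)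

/-- Smoothness and distortion enter the later arguments only through the constants produced here. -/
theorem exists_geometry (hab : a < b) (hτ : 0 < τ) : Nonempty (Geometry F) := by
  obtain ⟨ρ, C, hρ, hρ1, hC, hsl, hdist⟩ := exists_distortion F hab hτ
  have hC0 : 0 < C := by linarith
  have hba : 0 < b - a := sub_pos.2 hab
  have hcomp : ∀ w, IsCompact (cyl F w) := fun w =>
    isCompact_Icc.image_of_continuousOn (continuousOn_wordMap F hρ hsl w)
  have ha : a ∈ Icc a b := left_mem_Icc.2 hab.le
  have hb : b ∈ Icc a b := right_mem_Icc.2 hab.le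
  have hmem : ∀ w {x}, x ∈ Icc a b → wordMap F w x ∈ cyl F w := fun w x hx =>
    mem_image_of_mem _ hx
  have hle : ∀ {x y}, x ∈ Icc a b → y ∈ Icc a b → |x - y| ≤ b - a := fun {x y} hx hy =>
    abs_le.2 ⟨by linarith [hx.1, hx.2, hy.1, hy.2], by linarith [hx.1, hx.2, hy.1, hy.2]⟩
  have hpos : ∀ w, 0 < len F w := fun w =>
    lt_of_lt_of_le (abs_pos.2 (sub_ne_zero.2 fun h =>
      hab.ne ((wordMap_injOn_Icc F w) ha hb h))) (abs_sub_le_len (hmem w ha) (hmem w hb))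
  -- The entry C(b - a) serves the lower bound on len(uv), C / (b - a) the upper bound, and 1 makes
  -- log B nonnegative.
  set B := max 1 (max (C / (b - a)) (C * (b - a))) with hB
  have hB1 : 1 ≤ B := le_max_left _ _
  have hB2 : C / (b - a) ≤ B := (le_max_left _ _).trans (le_max_right _ _)
  have hB3 : C * (b - a) ≤ B := (le_max_right _ _).trans (le_max_right _ _)
  have hlower : ∀ u, ∀ x ∈ Icc a b, ∀ y ∈ Icc a b,
      len F u * |x - y| ≤ B * |wordMap F u x - wordMap F u y| := by
    intro u x hx y hy
    obtain ⟨p, hp, q, hq, he⟩ := exists_len_eq F hab u (hcomp u)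
    rw [he]
    calc _ ≤ _ := hdist u p hp q hq x hx y hy
      _ ≤ C * (|wordMap F u x - wordMap F u y| * (b - a)) := by
          gcongr
          exact hle hp hq
      _ = C * (b - a) * |wordMap F u x - wordMap F u y| := by ring
      _ ≤ _ := by gcongr
  have hmul : ∀ u v, len F u * len F v ≤ B * len F (u ++ v) := by
    intro u v
    obtain ⟨x, hx, y, hy, he⟩ := exists_len_eq F hab v (hcomp v)
    rw [he]
    refine (hlower u _ (wordMap_mem F v hx) _ (wordMap_mem F v hy)).trans ?_
    gcongr
    rw [← wordMap_append, ← wordMap_append]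
    exact abs_sub_le_len (hmem _ hx) (hmem _ hy)
  obtain ⟨m, hm⟩ := Finite.exists_ge fun l : Letter F => (⟨len F [l], hpos [l]⟩ : Ioi (0 : ℝ))
  obtain ⟨γ, hγ, hgap⟩ := exists_uniform_gap F
  have hm0 : (0 : ℝ) < m := m.2
  have hB0 : 0 < B := by linarith
  -- Here m bounds the one-letter cylinders from below and γ the gaps between pieces of one map;
  -- distortion transports both into any cylinder at the cost of B. The minimum with 1/2 forces θ <
  -- 1.
  refine ⟨⟨ρ, B, min (m / B) 2⁻¹, γ / B, hab, hρ, hρ1, hB1, by positivity,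
    (min_le_right _ _).trans_lt (by norm_num), by positivity, hcomp,
    ordConnected_cyl F hρ hsl, hpos, fun w => ?_, hmul, fun u v => ?_,
    fun u l => ?_, fun u j i i' v v' hi x hx y hy => ?_⟩⟩
  · exact Metric.diam_le_of_forall_dist_le (by positivity) fun x hx y hy =>
      abs_sub_le_of_mem_cyl F hρ hsl w hx hy
  · obtain ⟨x, hx, y, hy, he⟩ := exists_len_eq F hab (u ++ v) (hcomp _)
    rw [he, wordMap_append, wordMap_append]
    have h := hdist u _ (wordMap_mem F v hx) _ (wordMap_mem F v hy) b hb a ha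
    rw [abs_of_pos hba, ← le_div_iff₀ hba] at h
    refine h.trans ?_
    rw [mul_div_right_comm]
    gcongr
    · exact (hpos u).le
    · exact abs_sub_le_len (hmem u hb) (hmem u ha)
    · exact abs_sub_le_len (hmem v hx) (hmem v hy)
  · have h1 : (m : ℝ) ≤ len F [l] := hm l
    have h2 := hmul u [l]
    calc _ ≤ m / B * len F u := by
          gcongr
          · exact (hpos u).le
          · exact min_le_left _ _
      _ ≤ len F [l] / B * len F u := by
          gcongr
          exact (hpos u).le
      _ = (len F u * len F [l]) / B := by ring
      _ ≤ _ := (div_le_iff₀' hB0).2 h2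
  · rw [cyl_append] at hx hy
    obtain ⟨x, hx, rfl⟩ := hx
    obtain ⟨y, hy, rfl⟩ := hy
    have h1 := hgap j i i' hi x (cyl_cons_subset_piece F _ v hx) y
      (cyl_cons_subset_piece F _ v' hy)
    have h2 := hlower u x (cyl_subset F _ hx) y (cyl_subset F _ hy)
    rw [div_mul_eq_mul_div, div_le_iff₀ hB0, mul_comm _ B]
    refine le_trans ?_ h2
    rw [mul_comm]
    have := (hpos u).le
    gcongr

/-! ### Admissible words and partition sums. -/

/-- The words of length `n` whose letters are branches of the maps `F_{c_1}, …, F_{c_n}`. -/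
def words (c : ℕ → Fin k) : ℕ → Finset (List (Letter F))
  | 0 => {[]}
  | n + 1 => (Finset.univ ×ˢ words (fun m => c (m + 1)) n).map
      ⟨fun p : Fin (F (c 0)).q × List (Letter F) => ⟨c 0, p.1⟩ :: p.2, by
        rintro ⟨i, u⟩ ⟨i', u'⟩ h
        simpa using h⟩

variable {F}

lemma mem_words_zero {c : ℕ → Fin k} {w : List (Letter F)} : w ∈ words F c 0 ↔ w = [] := by
  simp [words]

lemma mem_words_succ {c : ℕ → Fin k} {n : ℕ} {w : List (Letter F)} :
    w ∈ words F c (n + 1) ↔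
      ∃ i, ∃ v ∈ words F (fun m => c (m + 1)) n, w = ⟨c 0, i⟩ :: v := by
  simp only [words, Finset.mem_map, Finset.mem_product, Finset.mem_univ, true_and,
    Prod.exists]
  constructor
  · rintro ⟨i, v, hv, rfl⟩
    exact ⟨i, v, hv, rfl⟩
  · rintro ⟨i, v, hv, rfl⟩
    exact ⟨i, v, hv, rfl⟩

lemma sum_words_succ (c : ℕ → Fin k) (n : ℕ) (φ : List (Letter F) → ℝ) :
    ∑ w ∈ words F c (n + 1), φ w =
      ∑ i, ∑ v ∈ words F (fun m => c (m + 1)) n, φ (⟨c 0, i⟩ :: v) := by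
  rw [words, Finset.sum_map, Finset.sum_product]
  rfl

lemma length_of_mem_words {c : ℕ → Fin k} {n : ℕ} {w : List (Letter F)}
    (hw : w ∈ words F c n) : w.length = n := by
  induction n generalizing c w with
  | zero => simp [mem_words_zero.1 hw]
  | succ n ih =>
    obtain ⟨i, v, hv, rfl⟩ := mem_words_succ.1 hw
    simp [ih hv]

lemma words_congr {c d : ℕ → Fin k} {n : ℕ} (h : ∀ m < n, c m = d m) :
    words F c n = words F d n := by
  induction n generalizing c d with
  | zero => rfl
  | succ n ih =>
    ext w
    rw [mem_words_succ, mem_words_succ, h 0 n.succ_pos,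
      ih fun m hm => h (m + 1) (Nat.succ_lt_succ hm)]

lemma words_nonempty (c : ℕ → Fin k) (n : ℕ) : (words F c n).Nonempty := by
  induction n generalizing c with
  | zero => exact ⟨[], by simp [words]⟩
  | succ n ih =>
    obtain ⟨v, hv⟩ := ih fun m => c (m + 1)
    exact ⟨_, mem_words_succ.2 ⟨⟨0, (F (c 0)).q_pos⟩, v, hv, rfl⟩⟩

lemma sum_words_add (c : ℕ → Fin k) (m n : ℕ) (φ : List (Letter F) → ℝ) :
    ∑ w ∈ words F c (m + n), φ w =
      ∑ u ∈ words F c m, ∑ v ∈ words F (fun l => c (m + l)) n, φ (u ++ v) := by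
  induction m generalizing c φ with
  | zero => simp [words]
  | succ m ih =>
    rw [Nat.succ_add, sum_words_succ, sum_words_succ]
    refine Finset.sum_congr rfl fun i _ => ?_
    rw [ih]
    simp only [List.cons_append, Nat.succ_add]

lemma exists_append_of_mem_words {c : ℕ → Fin k} {m n : ℕ} {w : List (Letter F)}
    (hw : w ∈ words F c (m + n)) :
    ∃ u ∈ words F c m, ∃ v ∈ words F (fun l => c (m + l)) n, w = u ++ v := by
  induction m generalizing c w with
  | zero => exact ⟨[], by simp [words], w, by simpa using hw, rfl⟩
  | succ m ih =>
    rw [Nat.succ_add, mem_words_succ] at hw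
    obtain ⟨i, w', hw', rfl⟩ := hw
    obtain ⟨u, hu, v, hv, rfl⟩ := ih hw'
    refine ⟨⟨c 0, i⟩ :: u, mem_words_succ.2 ⟨i, u, hu, rfl⟩, v, ?_, rfl⟩
    simpa only [Nat.succ_add] using hv

/-- Two distinct words of the same level split at some letter. -/
lemma exists_split {c : ℕ → Fin k} {n : ℕ} {w w' : List (Letter F)} (hw : w ∈ words F c n)
    (hw' : w' ∈ words F c n) (h : w ≠ w') :
    ∃ u j i i' v v', i ≠ i' ∧ w = u ++ (⟨j, i⟩ :: v) ∧ w' = u ++ (⟨j, i'⟩ :: v') := by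
  induction n generalizing c w w' with
  | zero => exact absurd ((mem_words_zero.1 hw).trans (mem_words_zero.1 hw').symm) h
  | succ n ih =>
    obtain ⟨i, v, hv, rfl⟩ := mem_words_succ.1 hw
    obtain ⟨i', v', hv', rfl⟩ := mem_words_succ.1 hw'
    -- Both words read the same sequence of maps, so at the first disagreement the two letters
    -- belong to one map and their pieces are disjoint.
    by_cases hi : i = i'
    · subst hi
      obtain ⟨u, j, l, l', r, r', hne, rfl, rfl⟩ := ih hv hv' (by rintro rfl; exact h rfl)
      exact ⟨⟨c 0, i⟩ :: u, j, l, l', r, r', hne, rfl, rfl⟩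
    · exact ⟨[], c 0, i, i', v, v', hi, rfl, rfl⟩

/-- For a constant sequence, words over the family are words over one map; this links `partSum` to
`partitionFn`. -/
lemma sum_words_const (j : Fin k) (n : ℕ) (φ : List (Letter F) → ℝ) :
    ∑ w ∈ words F (fun _ => j) n, φ w =
      ∑ w : Fin n → Fin (F j).q, φ ((List.ofFn w).map (Sigma.mk j)) := by
  induction n generalizing φ with
  | zero => simp [words]
  | succ n ih =>
    rw [sum_words_succ, ← (Fin.consEquiv fun _ => Fin (F j).q).sum_comp, Fintype.sum_prod_type]
    refine Finset.sum_congr rfl fun i _ => ?_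
    rw [ih]
    refine Finset.sum_congr rfl fun w _ => ?_
    simp [Fin.consEquiv, List.ofFn_succ]

lemma cylinder_eq_cyl (j : Fin k) (w : List (Fin (F j).q)) :
    (F j).cylinder w = cyl F (w.map (Sigma.mk j)) := by
  induction w with
  | nil => simp [cylinder]
  | cons i w ih => rw [cylinder, List.map_cons, cyl_cons, ih]

/-- The partition function `∑ |I_w|^s` over the words of length `n` admissible for `c`. -/
noncomputable def partSum (F : Fin k → CookieCutter a b τ) (c : ℕ → Fin k) (n : ℕ) (s : ℝ) : ℝ :=
  ∑ w ∈ words F c n, len F w ^ s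

lemma partitionFn_eq (j : Fin k) (n : ℕ) (s : ℝ) :
    (F j).partitionFn n s = partSum F (fun _ => j) n s := by
  rw [partSum, sum_words_const, partitionFn]
  refine Finset.sum_congr rfl fun w _ => ?_
  rw [cylinder_eq_cyl, len]

lemma partSum_congr {c d : ℕ → Fin k} {n : ℕ} (h : ∀ m < n, c m = d m) (s : ℝ) :
    partSum F c n s = partSum F d n s := by
  rw [partSum, partSum, words_congr h]

end CookieCutter

/-! ### Almost additivity and the pressure functions. -/

lemma Real.rpow_le_rpow_abs_mul {x y B : ℝ} (s : ℝ) (hx : 0 < x) (hy : 0 < y) (hB : 0 < B)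
    (hxy : x ≤ B * y) (hyx : y ≤ B * x) : x ^ s ≤ B ^ |s| * y ^ s := by
  rcases le_total 0 s with hs | hs
  · rw [abs_of_nonneg hs, ← Real.mul_rpow hB.le hy.le]
    exact Real.rpow_le_rpow hx.le hxy hs
  -- A negative exponent reverses the order, so here the opposite comparison is the relevant one;
  -- hence both are assumed.
  · have h := Real.rpow_le_rpow_of_nonpos (z := s) (by positivity) ((div_le_iff₀' hB).2 hyx) hs
    rw [Real.div_rpow hy.le hB.le] at h
    rwa [abs_of_nonpos hs, Real.rpow_neg hB.le, inv_mul_eq_div]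

/-- An almost additive sequence grows linearly up to a bounded error. -/
lemma exists_tendsto_of_almost_additive {u : ℕ → ℝ} {D : ℝ}
    (h : ∀ m n, |u (m + n) - (u m + u n)| ≤ D) :
    ∃ P, Tendsto (fun n : ℕ => u n / n) atTop (𝓝 P) ∧ ∀ n : ℕ, |u n - n * P| ≤ D := by
  have h0 : |u 0| ≤ D := by
    have := h 0 0
    rwa [add_zero, show u 0 - (u 0 + u 0) = -u 0 by ring, abs_neg] at this
  have hD : 0 ≤ D := (abs_nonneg _).trans h0
  have hlin : ∀ n : ℕ, |u n| ≤ D + n * (|u 1| + D) := by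
    intro n
    induction n with
    | zero => simpa using h0
    | succ n ih =>
      have h1 := abs_le.1 (h n 1)
      have h2 := abs_le.1 ih
      have h3 := abs_le.1 (le_refl |u 1|)
      push_cast
      rw [abs_le]
      constructor <;> linarith
  have hquot : ∀ n : ℕ, n ≠ 0 → |u n / n| ≤ D + (|u 1| + D) := by
    intro n hn
    have hn1 : (1 : ℝ) ≤ n := by exact_mod_cast Nat.one_le_iff_ne_zero.2 hn
    rw [abs_div, Nat.abs_cast, div_le_iff₀ (by positivity)]
    nlinarith [hlin n]
  -- Fekete's lemma applies to both u + D and -u + D. The two limits are opposite, and each is an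
  -- infimum, which gives the two halves of |u n - nP| ≤ D for every n.
  have hv : Subadditive fun n => u n + D := fun m n => by
    have := abs_le.1 (h m n)
    linarith
  have hw : Subadditive fun n => -u n + D := fun m n => by
    have := abs_le.1 (h m n)
    linarith
  have hDn : ∀ n : ℕ, 0 ≤ D / n := fun n => by positivity
  have hvb : BddBelow (range fun n : ℕ => (u n + D) / n) := by
    refine ⟨-(D + (|u 1| + D)), ?_⟩
    rintro _ ⟨n, rfl⟩
    rcases eq_or_ne n 0 with rfl | hn
    · simp only [CharP.cast_eq_zero, div_zero, Left.neg_nonpos_iff]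
      positivity
    · have := (abs_le.1 (hquot n hn)).1
      simp only [add_div]
      linarith [hDn n]
  have hwb : BddBelow (range fun n : ℕ => (-u n + D) / n) := by
    refine ⟨-(D + (|u 1| + D)), ?_⟩
    rintro _ ⟨n, rfl⟩
    rcases eq_or_ne n 0 with rfl | hn
    · simp only [CharP.cast_eq_zero, div_zero, Left.neg_nonpos_iff]
      positivity
    · have := (abs_le.1 (hquot n hn)).2
      simp only [add_div, neg_div]
      linarith [hDn n]
  have hD0 : Tendsto (fun n : ℕ => D / n) atTop (𝓝 0) := tendsto_const_div_atTop_nhds_zero_nat D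
  have hu : Tendsto (fun n : ℕ => u n / n) atTop (𝓝 hv.lim) := by
    have := (hv.tendsto_lim hvb).sub hD0
    simpa [add_div] using this
  have hlim : hw.lim = -hv.lim := by
    refine tendsto_nhds_unique (hw.tendsto_lim hwb) ?_
    have := hu.neg.add hD0
    simpa [add_div, neg_div] using this
  refine ⟨hv.lim, hu, fun n => ?_⟩
  rcases eq_or_ne n 0 with rfl | hn
  · simpa using h0
  · have hn0 : (0 : ℝ) < n := by exact_mod_cast Nat.pos_of_ne_zero hn
    have h1 := hv.lim_le_div hvb hn
    have h2 := hw.lim_le_div hwb hn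
    rw [hlim] at h2
    rw [le_div_iff₀ hn0] at h1 h2
    rw [abs_le]
    constructor <;> linarith

lemma tendsto_mul_add_const_div (r x y : ℝ) :
    Tendsto (fun n : ℕ => r * (x + y / n)) atTop (𝓝 (r * x)) := by
  have := ((tendsto_const_div_atTop_nhds_zero_nat (y)).const_add x).const_mul r
  simpa using this

namespace CookieCutter

variable {a b : ℝ} {τ : ℝ≥0} {k : ℕ} {F : Fin k → CookieCutter a b τ}

namespace Geometry

variable (G : Geometry F)
include G

lemma B_pos : 0 < G.B := zero_lt_one.trans_le G.one_le_B

lemma rpow_len_append_le (u v : List (Letter F)) (s : ℝ) :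
    len F (u ++ v) ^ s ≤ G.B ^ |s| * (len F u ^ s * len F v ^ s) := by
  rw [← Real.mul_rpow (G.len_pos u).le (G.len_pos v).le]
  exact Real.rpow_le_rpow_abs_mul s (G.len_pos _) (mul_pos (G.len_pos u) (G.len_pos v)) G.B_pos
    (G.len_append_le u v) (G.mul_le_len_append u v)

lemma mul_le_rpow_len_append (u v : List (Letter F)) (s : ℝ) :
    len F u ^ s * len F v ^ s ≤ G.B ^ |s| * len F (u ++ v) ^ s := by
  rw [← Real.mul_rpow (G.len_pos u).le (G.len_pos v).le]
  exact Real.rpow_le_rpow_abs_mul s (mul_pos (G.len_pos u) (G.len_pos v)) (G.len_pos _) G.B_pos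
    (G.mul_le_len_append u v) (G.len_append_le u v)

lemma partSum_pos (c : ℕ → Fin k) (n : ℕ) (s : ℝ) : 0 < partSum F c n s :=
  Finset.sum_pos (fun w _ => Real.rpow_pos_of_pos (G.len_pos w) s) (words_nonempty c n)

lemma partSum_add_le (c : ℕ → Fin k) (m n : ℕ) (s : ℝ) :
    partSum F c (m + n) s ≤
      G.B ^ |s| * (partSum F c m s * partSum F (fun l => c (m + l)) n s) := by
  simp only [partSum]
  rw [sum_words_add, Finset.sum_mul_sum, Finset.mul_sum]
  refine Finset.sum_le_sum fun u _ => ?_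
  rw [Finset.mul_sum]
  exact Finset.sum_le_sum fun v _ => G.rpow_len_append_le u v s

lemma mul_le_partSum_add (c : ℕ → Fin k) (m n : ℕ) (s : ℝ) :
    partSum F c m s * partSum F (fun l => c (m + l)) n s ≤
      G.B ^ |s| * partSum F c (m + n) s := by
  simp only [partSum]
  rw [sum_words_add, Finset.sum_mul_sum, Finset.mul_sum]
  refine Finset.sum_le_sum fun u _ => ?_
  rw [Finset.mul_sum]
  exact Finset.sum_le_sum fun v _ => G.mul_le_rpow_len_append u v s

/-- The error depends neither on c nor on m and n. It therefore yields the existence of the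
pressures and also controls the cost of a switch. -/
lemma abs_log_partSum_add_sub_le (c : ℕ → Fin k) (m n : ℕ) (s : ℝ) :
    |Real.log (partSum F c (m + n) s) - (Real.log (partSum F c m s) +
      Real.log (partSum F (fun l => c (m + l)) n s))| ≤ |s| * Real.log G.B := by
  have h1 := G.partSum_pos c m s
  have h2 := G.partSum_pos (fun l => c (m + l)) n s
  have h3 := G.partSum_pos c (m + n) s
  have hB := Real.rpow_pos_of_pos G.B_pos |s|
  have h4 := Real.log_le_log h3 (G.partSum_add_le c m n s)
  have h5 := Real.log_le_log (by positivity) (G.mul_le_partSum_add c m n s)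
  rw [Real.log_mul hB.ne' (by positivity), Real.log_mul h1.ne' h2.ne',
    Real.log_rpow G.B_pos] at h4
  rw [Real.log_mul hB.ne' h3.ne', Real.log_mul h1.ne' h2.ne', Real.log_rpow G.B_pos] at h5
  rw [abs_le]
  constructor <;> linarith

lemma log_B_nonneg : 0 ≤ Real.log G.B := Real.log_nonneg G.one_le_B

lemma pressure_spec (j : Fin k) (s : ℝ) :
    Tendsto (fun n : ℕ => (F j).pressureN n s) atTop (𝓝 ((F j).pressure s)) ∧
      ∀ n : ℕ, |Real.log (partSum F (fun _ => j) n s) - n * (F j).pressure s| ≤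
        |s| * Real.log G.B := by
  obtain ⟨P, hP, h⟩ := exists_tendsto_of_almost_additive
    (u := fun n => Real.log (partSum F (fun _ => j) n s))
    fun m n => G.abs_log_partSum_add_sub_le (fun _ => j) m n s
  have hP' : Tendsto (fun n : ℕ => (F j).pressureN n s) atTop (𝓝 P) := by
    refine hP.congr fun n => ?_
    rw [pressureN, partitionFn_eq]
    ring
  have he : (F j).pressure s = P := hP'.limUnder_eq
  rw [he]
  exact ⟨hP', h⟩

lemma pow_le_len (w : List (Letter F)) : G.θ ^ w.length * (b - a) ≤ len F w := by
  induction w using List.reverseRecOn with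
  | nil =>
    simp [len, Real.diam_Icc G.hab.le]
  | append_singleton w l ih =>
    refine le_trans ?_ (G.child w l)
    rw [List.length_append, List.length_singleton, pow_succ', mul_assoc]
    have := G.θ_pos
    gcongr

lemma interval_length_pos : 0 < b - a := sub_pos.2 G.hab

/-- Raising the exponent by t - s multiplies each term by at most (ρ^n (b - a))^(t - s). With the
mirror bound in θ, the difference quotients of the pressure lie between log θ and log ρ. -/
lemma log_partSum_le {c : ℕ → Fin k} {n : ℕ} {s t : ℝ} (hst : s ≤ t) :
    Real.log (partSum F c n t) ≤
      Real.log (partSum F c n s) + (t - s) * (n * Real.log G.ρ + Real.log (b - a)) := by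
  have hρ := G.ρ_pos
  have hba := G.interval_length_pos
  have hq : 0 < (G.ρ ^ n * (b - a)) ^ (t - s) := by positivity
  have h : partSum F c n t ≤ partSum F c n s * (G.ρ ^ n * (b - a)) ^ (t - s) := by
    simp only [partSum]
    rw [Finset.sum_mul]
    refine Finset.sum_le_sum fun w hw => ?_
    have h1 := G.len_le w
    rw [length_of_mem_words hw] at h1
    calc len F w ^ t = len F w ^ s * len F w ^ (t - s) := by
          rw [← Real.rpow_add (G.len_pos w)]
          ring_nf
      _ ≤ _ := by
          have := G.len_pos w
          gcongr
  have h' := Real.log_le_log (G.partSum_pos c n t) h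
  rwa [Real.log_mul (G.partSum_pos c n s).ne' hq.ne', Real.log_rpow (by positivity),
    Real.log_mul (by positivity) hba.ne', Real.log_pow] at h'

lemma le_log_partSum {c : ℕ → Fin k} {n : ℕ} {s t : ℝ} (hst : s ≤ t) :
    Real.log (partSum F c n s) + (t - s) * (n * Real.log G.θ + Real.log (b - a)) ≤
      Real.log (partSum F c n t) := by
  have hρ := G.θ_pos
  have hba := G.interval_length_pos
  have hq : 0 < (G.θ ^ n * (b - a)) ^ (t - s) := by positivity
  have h : partSum F c n s * (G.θ ^ n * (b - a)) ^ (t - s) ≤ partSum F c n t := by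
    simp only [partSum]
    rw [Finset.sum_mul]
    refine Finset.sum_le_sum fun w hw => ?_
    have h1 := G.pow_le_len w
    rw [length_of_mem_words hw] at h1
    calc _ ≤ len F w ^ s * len F w ^ (t - s) := by
          have := G.len_pos w
          gcongr
      _ = len F w ^ t := by
          rw [← Real.rpow_add (G.len_pos w)]
          ring_nf
  have h' := Real.log_le_log (mul_pos (G.partSum_pos c n s) hq) h
  rwa [Real.log_mul (G.partSum_pos c n s).ne' hq.ne', Real.log_rpow (by positivity),
    Real.log_mul (by positivity) hba.ne', Real.log_pow] at h'

lemma pressure_le (j : Fin k) {s t : ℝ} (hst : s ≤ t) :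
    (F j).pressure t ≤ (F j).pressure s + (t - s) * Real.log G.ρ := by
  refine le_of_tendsto_of_tendsto (G.pressure_spec j t).1
    ((G.pressure_spec j s).1.add (tendsto_mul_add_const_div (t - s) (Real.log G.ρ) (Real.log (b - a)))) ?_
  filter_upwards [eventually_gt_atTop 0] with n hn
  have hn' : (0 : ℝ) < n := by exact_mod_cast hn
  have h := G.log_partSum_le (c := fun _ => j) (n := n) hst
  rw [pressureN, pressureN, partitionFn_eq, partitionFn_eq, one_div, inv_mul_le_iff₀ hn']
  refine h.trans_eq ?_
  field_simp

lemma le_pressure (j : Fin k) {s t : ℝ} (hst : s ≤ t) :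
    (F j).pressure s + (t - s) * Real.log G.θ ≤ (F j).pressure t := by
  refine le_of_tendsto_of_tendsto
    ((G.pressure_spec j s).1.add (tendsto_mul_add_const_div (t - s) (Real.log G.θ) (Real.log (b - a))))
    (G.pressure_spec j t).1 ?_
  filter_upwards [eventually_gt_atTop 0] with n hn
  have hn' : (0 : ℝ) < n := by exact_mod_cast hn
  have h := G.le_log_partSum (c := fun _ => j) (n := n) hst
  rw [pressureN, pressureN, partitionFn_eq, partitionFn_eq, one_div, le_inv_mul_iff₀ hn']
  refine le_trans (le_of_eq ?_) h
  field_simp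

lemma dist_ge_of_ne {c : ℕ → Fin k} {n : ℕ} {w w' : List (Letter F)} (hw : w ∈ words F c n)
    (hw' : w' ∈ words F c n) (h : w ≠ w') {x y : ℝ} (hx : x ∈ cyl F w) (hy : y ∈ cyl F w') :
    G.δ * len F w ≤ |x - y| := by
  obtain ⟨u, j, i, i', v, v', hi, rfl, rfl⟩ := exists_split hw hw' h
  refine le_trans ?_ (G.gap u j i i' v v' hi x hx y hy)
  have := G.δ_pos
  gcongr
  exact Metric.diam_mono (cyl_append_subset F u _) (isBounded_cyl F u)

lemma disjoint_cyl {c : ℕ → Fin k} {n : ℕ} {w w' : List (Letter F)} (hw : w ∈ words F c n)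
    (hw' : w' ∈ words F c n) (h : w ≠ w') : Disjoint (cyl F w) (cyl F w') := by
  rw [Set.disjoint_left]
  intro x hx hx'
  have := G.dist_ge_of_ne hw hw' h hx hx'
  rw [sub_self, abs_zero] at this
  exact absurd this (not_le.2 (mul_pos G.δ_pos (G.len_pos w)))

lemma cyl_nonempty (w : List (Letter F)) : (cyl F w).Nonempty :=
  ⟨_, mem_image_of_mem _ (left_mem_Icc.2 G.hab.le)⟩

lemma volume_cyl (w : List (Letter F)) :
    MeasureTheory.volume (cyl F w) = ENNReal.ofReal (len F w) := by
  have h := eq_Icc_of_connected_compact ⟨G.cyl_nonempty w, (G.ordConnected_cyl w).isPreconnected⟩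
    (G.isCompact_cyl w)
  have hle : sInf (cyl F w) ≤ sSup (cyl F w) := by
    rw [← nonempty_Icc, ← h]
    exact G.cyl_nonempty w
  rw [len, h, Real.volume_Icc, Real.diam_Icc hle]

/-- Cylinders of one level are disjoint intervals in [a, b], so their Lebesgue measures add up to at
most b - a. This is what places the roots in [0, 1]. -/
lemma partSum_one_le (c : ℕ → Fin k) (n : ℕ) : partSum F c n 1 ≤ b - a := by
  have h1 : MeasureTheory.volume (⋃ w ∈ words F c n, cyl F w) =
      ∑ w ∈ words F c n, MeasureTheory.volume (cyl F w) :=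
    MeasureTheory.measure_biUnion_finset
      (fun w hw w' hw' hne => G.disjoint_cyl hw hw' hne)
      fun w _ => (G.isCompact_cyl w).measurableSet
  have h2 : MeasureTheory.volume (⋃ w ∈ words F c n, cyl F w) ≤
      MeasureTheory.volume (Icc a b) :=
    MeasureTheory.measure_mono (iUnion₂_subset fun w _ => cyl_subset F w)
  rw [h1, Real.volume_Icc] at h2
  simp only [G.volume_cyl] at h2
  rw [← ENNReal.ofReal_sum_of_nonneg fun w _ => (G.len_pos w).le,
    ENNReal.ofReal_le_ofReal_iff G.interval_length_pos.le] at h2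
  simpa [partSum] using h2

lemma pressure_zero_nonneg (j : Fin k) : 0 ≤ (F j).pressure 0 := by
  refine ge_of_tendsto' (G.pressure_spec j 0).1 fun n => ?_
  rw [pressureN, partitionFn_eq]
  refine mul_nonneg (by positivity) (Real.log_nonneg ?_)
  simp only [partSum, Real.rpow_zero, Finset.sum_const, nsmul_eq_mul, mul_one]
  exact_mod_cast (words_nonempty (F := F) (fun _ => j) n).card_pos

lemma pressure_one_nonpos (j : Fin k) : (F j).pressure 1 ≤ 0 := by
  have h0 : Tendsto (fun n : ℕ => Real.log (b - a) / n) atTop (𝓝 0) :=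
    tendsto_const_div_atTop_nhds_zero_nat _
  refine le_of_tendsto_of_tendsto' (G.pressure_spec j 1).1 h0 fun n => ?_
  rw [pressureN, partitionFn_eq, one_div, inv_mul_eq_div]
  gcongr
  · exact G.partSum_pos _ n 1
  · exact G.partSum_one_le _ n

end Geometry

end CookieCutter

/-! ### Frequencies, roots, and growth of partition sums. -/

lemma freq_mem_stdSimplex {k : ℕ} (c : ℕ → Fin k) {n : ℕ} (hn : n ≠ 0) :
    freq c n ∈ stdSimplex ℝ (Fin k) := by
  have hn' : (n : ℝ) ≠ 0 := by exact_mod_cast hn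
  refine ⟨fun j => by unfold freq; positivity, ?_⟩
  simp only [freq]
  rw [← Finset.sum_div, div_eq_one_iff_eq hn', ← Nat.cast_sum,
    ← Finset.card_eq_sum_card_fiberwise (fun _ _ => Finset.mem_coe.2 (Finset.mem_univ _)),
    Finset.card_range]

lemma sum_range_comp_eq_freq {k : ℕ} (c : ℕ → Fin k) (n : ℕ) (φ : Fin k → ℝ) :
    ∑ m ∈ Finset.range n, φ (c m) = n * ∑ j, freq c n j * φ j := by
  rcases eq_or_ne n 0 with rfl | hn
  · simp
  have hn' : (n : ℝ) ≠ 0 := by exact_mod_cast hn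
  rw [← Finset.sum_fiberwise (Finset.range n) c, Finset.mul_sum]
  refine Finset.sum_congr rfl fun j _ => ?_
  rw [Finset.sum_congr rfl fun m hm => by rw [(Finset.mem_filter.1 hm).2], Finset.sum_const,
    freq, nsmul_eq_mul]
  field_simp

lemma switchCount_succ_succ {k : ℕ} (c : ℕ → Fin k) (n : ℕ) :
    switchCount c (n + 2) = switchCount c (n + 1) + if c n ≠ c (n + 1) then 1 else 0 := by
  simp only [switchCount, Nat.add_one_sub_one]
  rw [Finset.range_add_one, Finset.filter_insert]
  split_ifs with h
  · rw [Finset.card_insert_of_notMem (by simp)]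
  · simp

namespace CookieCutter

variable {a b : ℝ} {τ : ℝ≥0} {k : ℕ} {F : Fin k → CookieCutter a b τ}

namespace Geometry

variable (G : Geometry F)
include G

lemma log_ρ_neg : Real.log G.ρ < 0 := Real.log_neg G.ρ_pos G.ρ_lt_one

lemma sum_pressure_le {α : Fin k → ℝ} (hα : α ∈ stdSimplex ℝ (Fin k)) {s t : ℝ} (hst : s ≤ t) :
    ∑ j, α j * (F j).pressure t ≤ ∑ j, α j * (F j).pressure s + (t - s) * Real.log G.ρ := by
  calc _ ≤ ∑ j, α j * ((F j).pressure s + (t - s) * Real.log G.ρ) :=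
        Finset.sum_le_sum fun j _ => mul_le_mul_of_nonneg_left (G.pressure_le j hst) (hα.1 j)
    _ = _ := by
        simp only [mul_add, Finset.sum_add_distrib]
        rw [← Finset.sum_mul, hα.2, one_mul]

lemma sum_pressure_strictAnti {α : Fin k → ℝ} (hα : α ∈ stdSimplex ℝ (Fin k)) :
    StrictAnti fun s => ∑ j, α j * (F j).pressure s := by
  intro s t hst
  have h := G.sum_pressure_le hα hst.le
  have := mul_neg_of_pos_of_neg (sub_pos.2 hst) G.log_ρ_neg
  simp only
  linarith

lemma continuous_pressure (j : Fin k) : Continuous (F j).pressure := by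
  have hθ : 0 ≤ -Real.log G.θ := by
    have := Real.log_neg G.θ_pos G.θ_lt_one
    linarith
  have key : ∀ s t : ℝ, s ≤ t →
      |(F j).pressure s - (F j).pressure t| ≤ -Real.log G.θ * |s - t| := by
    intro s t hst
    have h1 := G.pressure_le j hst
    have h2 := G.le_pressure j hst
    have h3 : (t - s) * Real.log G.ρ ≤ 0 :=
      mul_nonpos_of_nonneg_of_nonpos (sub_nonneg.2 hst) G.log_ρ_neg.le
    rw [abs_of_nonneg (by linarith), abs_of_nonpos (by linarith)]
    linarith
  refine (LipschitzWith.of_dist_le_mul (K := ⟨-Real.log G.θ, hθ⟩) fun s t => ?_).continuous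
  rw [Real.dist_eq, Real.dist_eq]
  rcases le_total s t with h | h
  · exact key s t h
  · rw [abs_sub_comm, abs_sub_comm s]
    exact key t s h

lemma root_spec {α : Fin k → ℝ} (hα : α ∈ stdSimplex ℝ (Fin k)) :
    root F α ∈ Icc (0 : ℝ) 1 ∧ ∑ j, α j * (F j).pressure (root F α) = 0 := by
  have hcont : Continuous fun s => ∑ j, α j * (F j).pressure s :=
    continuous_finsetSum _ fun j _ => continuous_const.mul (G.continuous_pressure j)
  have h0 : 0 ≤ ∑ j, α j * (F j).pressure 0 :=
    Finset.sum_nonneg fun j _ => mul_nonneg (hα.1 j) (G.pressure_zero_nonneg j)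
  have h1 : ∑ j, α j * (F j).pressure 1 ≤ 0 :=
    Finset.sum_nonpos fun j _ =>
      mul_nonpos_of_nonneg_of_nonpos (hα.1 j) (G.pressure_one_nonpos j)
  obtain ⟨s, hs, he⟩ := intermediate_value_Icc' zero_le_one hcont.continuousOn ⟨h1, h0⟩
  exact Classical.epsilon_spec (p := fun s : ℝ => s ∈ Icc (0 : ℝ) 1 ∧
    ∑ j, α j * (F j).pressure s = 0) ⟨s, hs, he⟩

lemma sum_pressure_eq_zero_iff {α : Fin k → ℝ} (hα : α ∈ stdSimplex ℝ (Fin k)) (s : ℝ) :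
    ∑ j, α j * (F j).pressure s = 0 ↔ s = root F α := by
  constructor
  · intro h
    exact (G.sum_pressure_strictAnti hα).injective (h.trans (G.root_spec hα).2.symm)
  · rintro rfl
    exact (G.root_spec hα).2

lemma le_sum_pressure {α : Fin k → ℝ} (hα : α ∈ stdSimplex ℝ (Fin k)) {s : ℝ}
    (hs : s ≤ root F α) :
    (root F α - s) * -Real.log G.ρ ≤ ∑ j, α j * (F j).pressure s := by
  have := G.sum_pressure_le hα hs
  rw [(G.root_spec hα).2] at this
  linarith

lemma sum_pressure_le_of_root_le {α : Fin k → ℝ} (hα : α ∈ stdSimplex ℝ (Fin k)) {s : ℝ}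
    (hs : root F α ≤ s) :
    ∑ j, α j * (F j).pressure s ≤ (s - root F α) * Real.log G.ρ := by
  have := G.sum_pressure_le hα hs
  rw [(G.root_spec hα).2] at this
  linarith

/-- The uniform rate of decrease makes the value at s control the distance to the root. Evaluating
the combination for nearby weights at a fixed root then gives continuity of `root`. -/
lemma abs_sub_root_le {α : Fin k → ℝ} (hα : α ∈ stdSimplex ℝ (Fin k)) (s : ℝ) :
    |root F α - s| ≤ |∑ j, α j * (F j).pressure s| / -Real.log G.ρ := by
  have hρ : 0 < -Real.log G.ρ := neg_pos.2 G.log_ρ_neg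
  rw [le_div_iff₀ hρ]
  rcases le_total s (root F α) with h | h
  · rw [abs_of_nonneg (sub_nonneg.2 h)]
    exact (G.le_sum_pressure hα h).trans (le_abs_self _)
  · rw [abs_of_nonpos (sub_nonpos.2 h)]
    have := G.sum_pressure_le_of_root_le hα h
    refine le_trans ?_ (neg_le_abs _)
    linarith

lemma continuousOn_root : ContinuousOn (root F) (stdSimplex ℝ (Fin k)) := by
  intro α hα
  have hcont : Tendsto (fun β : Fin k → ℝ =>
      |∑ j, β j * (F j).pressure (root F α)| / -Real.log G.ρ)
      (𝓝[stdSimplex ℝ (Fin k)] α) (𝓝 0) := by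
    have h : Continuous fun β : Fin k → ℝ =>
        |∑ j, β j * (F j).pressure (root F α)| / -Real.log G.ρ := by fun_prop
    have h' := (h.tendsto α).mono_left (nhdsWithin_le_nhds (s := stdSimplex ℝ (Fin k)))
    simpa [(G.root_spec hα).2] using h'
  rw [ContinuousWithinAt, tendsto_iff_dist_tendsto_zero]
  refine squeeze_zero' (Eventually.of_forall fun _ => dist_nonneg) ?_ hcont
  filter_upwards [self_mem_nhdsWithin] with β hβ
  exact G.abs_sub_root_le hβ _

/-- The error in approximating the partition function by the sum of the pressures. -/
lemma abs_error_add_le {c : ℕ → Fin k} {m p : ℕ} {j : Fin k} (h : ∀ l < p, c (m + l) = j)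
    (s : ℝ) :
    |Real.log (partSum F c (m + p) s) - ∑ l ∈ Finset.range (m + p), (F (c l)).pressure s| ≤
      |Real.log (partSum F c m s) - ∑ l ∈ Finset.range m, (F (c l)).pressure s| +
        2 * (|s| * Real.log G.B) := by
  -- One error |s| log B pays for splitting off the block, a second for replacing its partition sum
  -- by p times the pressure.
  have h1 := G.abs_log_partSum_add_sub_le c m p s
  have h2 := (G.pressure_spec j s).2 p
  rw [partSum_congr (d := fun _ => j) h] at h1
  have h3 : ∑ l ∈ Finset.range p, (F (c (m + l))).pressure s = p * (F j).pressure s := by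
    rw [Finset.sum_congr rfl fun l hl => by rw [h l (Finset.mem_range.1 hl)]]
    simp
  rw [Finset.sum_range_add, h3]
  have h4 := abs_le.1 (le_refl
    |Real.log (partSum F c m s) - ∑ l ∈ Finset.range m, (F (c l)).pressure s|)
  rw [abs_le] at h1 h2 ⊢
  constructor <;> linarith

lemma exists_abs_error_le (c : ℕ → Fin k) (s : ℝ) :
    ∃ K : ℝ, 0 ≤ K ∧ ∀ n,
      |Real.log (partSum F c n s) - ∑ l ∈ Finset.range n, (F (c l)).pressure s| ≤
        K * (switchCount c n + 1) := by
  set E : ℕ → ℝ := fun n =>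
    |Real.log (partSum F c n s) - ∑ l ∈ Finset.range n, (F (c l)).pressure s| with hE
  set D := |s| * Real.log G.B with hD
  have hD0 : 0 ≤ D := mul_nonneg (abs_nonneg s) G.log_B_nonneg
  have hE0 : 0 ≤ E 0 := abs_nonneg _
  set K := E 0 + 2 * D with hK
  have hK0 : 0 ≤ K := by positivity
  -- The index m starts the constant block containing n. Tracking the error only at block starts
  -- makes each switch cost 2D, whatever the block lengths.
  have claim : ∀ n, ∃ m ≤ n, (∀ l, m ≤ l → l ≤ n → c l = c n) ∧
      E m ≤ K * (switchCount c (n + 1) + 1) := by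
    intro n
    induction n with
    | zero =>
      refine ⟨0, le_rfl, fun l _ hl => by rw [Nat.le_zero.1 hl], ?_⟩
      have h0 : (0 : ℝ) ≤ switchCount c (0 + 1) := Nat.cast_nonneg _
      nlinarith
    | succ n ih =>
      obtain ⟨m, hm, hc, hle⟩ := ih
      by_cases hn : c n = c (n + 1)
      · refine ⟨m, hm.trans n.le_succ, fun l hl hl' => ?_, ?_⟩
        · rcases Nat.le_succ_iff.1 hl' with h | rfl
          · rw [hc l hl h, hn]
          · rfl
        · rw [switchCount_succ_succ]
          simpa [hn] using hle
      · refine ⟨n + 1, le_rfl, fun l hl hl' => by rw [le_antisymm hl' hl], ?_⟩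
        have h := G.abs_error_add_le (c := c) (m := m) (p := n + 1 - m) (j := c n)
          (fun l hl => hc _ (Nat.le_add_right _ _) (by omega)) s
        rw [Nat.add_sub_cancel' (hm.trans n.le_succ)] at h
        rw [switchCount_succ_succ, if_pos hn]
        push_cast
        change E (n + 1) ≤ E m + 2 * D at h
        linarith
  refine ⟨2 * K, by positivity, fun n => ?_⟩
  have hs : (0 : ℝ) ≤ switchCount c n := Nat.cast_nonneg _
  rcases n with _ | n
  · change E 0 ≤ _
    nlinarith
  · obtain ⟨m, hm, hc, hle⟩ := claim n
    have h := G.abs_error_add_le (c := c) (m := m) (p := n + 1 - m) (j := c n)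
      (fun l hl => hc _ (Nat.le_add_right _ _) (by omega)) s
    rw [Nat.add_sub_cancel' (hm.trans n.le_succ)] at h
    change E (n + 1) ≤ E m + 2 * D at h
    change E (n + 1) ≤ _
    nlinarith

lemma eventually_abs_error_le {c : ℕ → Fin k} (hc : RarelySwitching c) (s : ℝ) {ε : ℝ}
    (hε : 0 < ε) :
    ∀ᶠ n : ℕ in atTop,
      |Real.log (partSum F c n s) - n * ∑ j, freq c n j * (F j).pressure s| ≤ ε * n := by
  obtain ⟨K, hK, h⟩ := G.exists_abs_error_le c s
  have h1 := hc.bound (c := ε / (2 * (K + 1))) (by positivity)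
  filter_upwards [h1, eventually_ge_atTop (⌈2 * K / ε⌉₊)] with n h1 h2
  rw [← sum_range_comp_eq_freq c n fun j => (F j).pressure s]
  refine (h n).trans ?_
  simp only [Real.norm_natCast] at h1
  have h3 : 2 * K / ε ≤ n := (Nat.le_ceil _).trans (by exact_mod_cast h2)
  rw [div_le_iff₀ hε] at h3
  have h4 : K * switchCount c n ≤ ε * n / 2 := by
    calc K * switchCount c n ≤ (K + 1) * (ε / (2 * (K + 1)) * n) := by
          gcongr
          linarith
      _ = _ := by field_simp
  linarith

/-- If the root of the frequencies stays below `s`, the partition function decays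
exponentially. -/
lemma eventually_partSum_le {c : ℕ → Fin k} (hc : RarelySwitching c) (s : ℝ) {η : ℝ}
    (hη : 0 < η) :
    ∃ r : ℝ, 0 < r ∧ r < 1 ∧ ∀ᶠ n : ℕ in atTop,
      root F (freq c n) + η ≤ s → partSum F c n s ≤ r ^ n := by
  have hρ : 0 < -Real.log G.ρ := neg_pos.2 G.log_ρ_neg
  refine ⟨Real.exp (-(η * -Real.log G.ρ / 2)), Real.exp_pos _,
    Real.exp_lt_one_iff.2 (by simp only [Left.neg_neg_iff]; positivity), ?_⟩
  -- Half of the rate η(-log ρ) is spent on the o(n) error; the other half is the exponential rate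
  -- that remains.
  filter_upwards [G.eventually_abs_error_le hc s (ε := η * -Real.log G.ρ / 2) (by positivity),
    eventually_ne_atTop 0] with n h hn hr
  have h1 := G.sum_pressure_le_of_root_le (freq_mem_stdSimplex c hn) (s := s) (by linarith)
  rw [← Real.exp_nat_mul, ← Real.log_le_iff_le_exp (G.partSum_pos c n s)]
  have h2 := (abs_le.1 h).2
  have h3 : (n : ℝ) * ∑ j, freq c n j * (F j).pressure s ≤ n * (η * Real.log G.ρ) := by
    gcongr
    refine h1.trans ?_
    nlinarith
  linarith

/-- If the root of the frequencies stays above `s`, the partition function grows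
exponentially. -/
lemma eventually_le_partSum {c : ℕ → Fin k} (hc : RarelySwitching c) (s : ℝ) {η : ℝ}
    (hη : 0 < η) :
    ∃ r : ℝ, 1 < r ∧ ∀ᶠ n : ℕ in atTop,
      s + η ≤ root F (freq c n) → r ^ n ≤ partSum F c n s := by
  have hρ : 0 < -Real.log G.ρ := neg_pos.2 G.log_ρ_neg
  refine ⟨Real.exp (η * -Real.log G.ρ / 2), Real.one_lt_exp_iff.2 (by positivity), ?_⟩
  filter_upwards [G.eventually_abs_error_le hc s (ε := η * -Real.log G.ρ / 2) (by positivity),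
    eventually_ne_atTop 0] with n h hn hr
  have h1 := G.le_sum_pressure (freq_mem_stdSimplex c hn) (s := s) (by linarith)
  rw [← Real.exp_nat_mul, ← Real.le_log_iff_exp_le (G.partSum_pos c n s)]
  have h2 := (abs_le.1 h).1
  have h3 : (n : ℝ) * (η * -Real.log G.ρ) ≤ n * ∑ j, freq c n j * (F j).pressure s := by
    gcongr
    refine le_trans ?_ h1
    nlinarith
  linarith

end Geometry

end CookieCutter

/-! ### The limit set and its covers by cylinders. -/

lemma Finset.sum_biUnion_le_sum_sum {ι α : Type*} [DecidableEq α] {f : α → ℝ}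
    (hf : ∀ x, 0 ≤ f x) (s : Finset ι) (t : ι → Finset α) :
    ∑ x ∈ s.biUnion t, f x ≤ ∑ i ∈ s, ∑ x ∈ t i, f x := by
  classical
  induction s using Finset.induction_on with
  | empty => simp
  | insert i s hi ih =>
    rw [Finset.biUnion_insert, Finset.sum_insert hi]
    have h := Finset.sum_union_inter (s₁ := t i) (s₂ := s.biUnion t) (f := f)
    have h' : 0 ≤ ∑ x ∈ t i ∩ s.biUnion t, f x := Finset.sum_nonneg fun x _ => hf x
    linarith

namespace CookieCutter

variable {a b : ℝ} {τ : ℝ≥0} {k : ℕ} {F : Fin k → CookieCutter a b τ}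

lemma orbit_succ (c : ℕ → Fin k) (x : ℝ) (n : ℕ) :
    orbit F c x (n + 1) = orbit F (fun m => c (m + 1)) ((F (c 0)).toFun x) n := by
  induction n with
  | zero => rfl
  | succ n ih => rw [orbit, ih, orbit]

/-- Applying the first map shifts the sequence; inductions on the level therefore generalize over c.
-/
lemma mem_limitSet_succ {c : ℕ → Fin k} {x : ℝ} :
    x ∈ limitSet F c ↔
      ∃ i, ∃ y ∈ limitSet F (fun m => c (m + 1)), x = (F (c 0)).branch i y := by
  constructor
  · rintro ⟨-, h⟩
    obtain ⟨i, hi⟩ := mem_iUnion.1 (h 0)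
    change x ∈ (F (c 0)).piece i at hi
    refine ⟨i, (F (c 0)).toFun x, ⟨((F (c 0)).bijOn i).mapsTo hi, fun n => ?_⟩,
      (branch_toFun _ i hi).symm⟩
    rw [← orbit_succ]
    exact h (n + 1)
  · rintro ⟨i, y, ⟨hy, h⟩, rfl⟩
    refine ⟨branch_mem_Icc _ i hy, fun n => ?_⟩
    cases n with
    | zero => exact mem_iUnion.2 ⟨i, branch_mem _ i hy⟩
    | succ n =>
      rw [orbit_succ, toFun_branch _ i hy]
      exact h n

lemma wordMap_mem_limitSet {c : ℕ → Fin k} {m : ℕ} {w : List (Letter F)}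
    (hw : w ∈ words F c m) {y : ℝ} (hy : y ∈ limitSet F (fun l => c (m + l))) :
    wordMap F w y ∈ limitSet F c := by
  induction m generalizing c w with
  | zero => simpa [mem_words_zero.1 hw] using hy
  | succ m ih =>
    obtain ⟨i, v, hv, rfl⟩ := mem_words_succ.1 hw
    refine mem_limitSet_succ.2 ⟨i, _, ih hv ?_, rfl⟩
    simpa only [Nat.succ_add] using hy

lemma exists_cyl_of_mem_limitSet {c : ℕ → Fin k} {x : ℝ} (hx : x ∈ limitSet F c) (n : ℕ) :
    ∃ w ∈ words F c n, x ∈ cyl F w := by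
  induction n generalizing c x with
  | zero => exact ⟨[], by simp [words], by simpa using hx.1⟩
  | succ n ih =>
    obtain ⟨i, y, hy, rfl⟩ := mem_limitSet_succ.1 hx
    obtain ⟨w, hw, hyw⟩ := ih hy
    refine ⟨_, mem_words_succ.2 ⟨i, w, hw, rfl⟩, ?_⟩
    rw [cyl_cons]
    exact mem_image_of_mem _ hyw

lemma orbit_mem_domain {c : ℕ → Fin k} {x : ℝ} {n : ℕ} {w : List (Letter F)}
    (hw : w ∈ words F c (n + 1)) (hx : x ∈ cyl F w) : orbit F c x n ∈ (F (c n)).domain := by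
  induction n generalizing c x w with
  | zero =>
    obtain ⟨i, v, hv, rfl⟩ := mem_words_succ.1 hw
    exact mem_iUnion.2 ⟨i, cyl_cons_subset_piece F _ v hx⟩
  | succ n ih =>
    obtain ⟨i, v, hv, rfl⟩ := mem_words_succ.1 hw
    rw [cyl_cons] at hx
    obtain ⟨y, hy, rfl⟩ := hx
    rw [orbit_succ, toFun_branch _ i (cyl_subset F v hy)]
    exact ih hv hy

lemma limitSet_eq_iInter (c : ℕ → Fin k) :
    limitSet F c = ⋂ n, ⋃ w ∈ words F c n, cyl F w := by
  ext x
  simp only [mem_iInter, mem_iUnion, exists_prop]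
  refine ⟨exists_cyl_of_mem_limitSet, fun h => ⟨?_, fun n => ?_⟩⟩
  · obtain ⟨w, -, hx⟩ := h 0
    exact cyl_subset F w hx
  · obtain ⟨w, hw, hx⟩ := h (n + 1)
    exact orbit_mem_domain hw hx

namespace Geometry

variable (G : Geometry F)
include G

lemma isCompact_level (c : ℕ → Fin k) (n : ℕ) : IsCompact (⋃ w ∈ words F c n, cyl F w) :=
  (words F c n).isCompact_biUnion fun w _ => G.isCompact_cyl w

lemma isCompact_limitSet (c : ℕ → Fin k) : IsCompact (limitSet F c) := by
  rw [limitSet_eq_iInter]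
  exact (G.isCompact_level c 0).of_isClosed_subset
    (isClosed_iInter fun n => (G.isCompact_level c n).isClosed) (iInter_subset _ 0)

lemma limitSet_nonempty (c : ℕ → Fin k) : (limitSet F c).Nonempty := by
  rw [limitSet_eq_iInter]
  refine IsCompact.nonempty_iInter_of_sequence_nonempty_isCompact_isClosed _ (fun n => ?_)
    (fun n => ?_) (G.isCompact_level c 0) fun n => (G.isCompact_level c n).isClosed
  · refine iUnion₂_subset fun w hw => ?_
    obtain ⟨u, hu, v, -, rfl⟩ := exists_append_of_mem_words hw
    exact (cyl_append_subset F u v).trans (subset_biUnion_of_mem (u := cyl F) hu)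
  · obtain ⟨w, hw⟩ := words_nonempty (F := F) c n
    exact (G.cyl_nonempty w).mono (subset_biUnion_of_mem (u := cyl F) hw)

lemma exists_mem_limitSet_cyl {c : ℕ → Fin k} {n : ℕ} {w : List (Letter F)}
    (hw : w ∈ words F c n) : ∃ x ∈ limitSet F c, x ∈ cyl F w := by
  obtain ⟨y, hy⟩ := G.limitSet_nonempty fun l => c (n + l)
  exact ⟨_, wordMap_mem_limitSet hw hy, mem_image_of_mem _ hy.1⟩

lemma eq_of_mem_cyl {c : ℕ → Fin k} {n : ℕ} {w w' : List (Letter F)} (hw : w ∈ words F c n)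
    (hw' : w' ∈ words F c n) {x : ℝ} (hx : x ∈ cyl F w) (hx' : x ∈ cyl F w') : w = w' := by
  by_contra h
  exact Set.disjoint_left.1 (G.disjoint_cyl hw hw' h) hx hx'

lemma child_of_mem_words {c : ℕ → Fin k} {n : ℕ} {w : List (Letter F)}
    (hw : w ∈ words F c (n + 1)) :
    ∃ u ∈ words F c n, cyl F w ⊆ cyl F u ∧ G.θ * len F u ≤ len F w := by
  obtain ⟨u, hu, v, hv, rfl⟩ := exists_append_of_mem_words hw
  obtain ⟨l, rfl⟩ := List.length_eq_one_iff.1 (length_of_mem_words hv)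
  exact ⟨u, hu, cyl_append_subset F u _, G.child u l⟩

lemma tendsto_pow_mul_sub : Tendsto (fun n : ℕ => G.ρ ^ n * (b - a)) atTop (𝓝 0) := by
  simpa using (tendsto_pow_atTop_nhds_zero_of_lt_one G.ρ_pos.le G.ρ_lt_one).mul_const (b - a)

lemma len_le_of_mem_words {c : ℕ → Fin k} {n : ℕ} {w : List (Letter F)}
    (hw : w ∈ words F c n) : len F w ≤ G.ρ ^ n * (b - a) := by
  have := G.len_le w
  rwa [length_of_mem_words hw] at this

/-- The part of the limit set in a set `U` lies in a cylinder which is arbitrarily small or of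
size comparable to `U`. -/
lemma exists_cyl_superset (c : ℕ → Fin k) {U : Set ℝ} (hU : (U ∩ limitSet F c).Nonempty)
    (hb : Bornology.IsBounded U) {ε : ℝ} (hε : 0 < ε) :
    ∃ n, ∃ u ∈ words F c n, U ∩ limitSet F c ⊆ cyl F u ∧
      (len F u ≤ ε ∨ len F u ≤ (G.δ * G.θ)⁻¹ * Metric.diam U) := by
  classical
  -- If every level has a cylinder containing the whole trace of U (as for a single point), it can
  -- be taken as small as desired; `diam U` may vanish then.
  by_cases hall : ∀ n, ∃ u ∈ words F c n, U ∩ limitSet F c ⊆ cyl F u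
  · obtain ⟨n, hn⟩ := (G.tendsto_pow_mul_sub.eventually_lt_const hε).exists
    obtain ⟨u, hu, hsub⟩ := hall n
    exact ⟨n, u, hu, hsub, Or.inl ((G.len_le_of_mem_words hu).trans hn.le)⟩
  · push Not at hall
    -- At the first level n + 1 where no cylinder suffices, two points of the trace lie in different
    -- cylinders. The gap bound compares the size of such a cylinder with `diam U`, and θ compares
    -- it with its parent u.
    have hspec := Nat.find_spec hall
    have hmin := fun m => Nat.find_min hall (m := m)
    rcases hn : Nat.find hall with _ | n
    · rw [hn] at hspec
      exact absurd (fun x hx => by simpa using hx.2.1) (hspec [] (by simp [words]))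
    · rw [hn] at hspec
      have := hmin n (by omega)
      push Not at this
      obtain ⟨u, hu, hsub⟩ := this
      obtain ⟨x, hx⟩ := hU
      obtain ⟨w, hw, hxw⟩ := exists_cyl_of_mem_limitSet hx.2 (n + 1)
      obtain ⟨y, hy, hyw⟩ := not_subset.1 (hspec w hw)
      obtain ⟨w', hw', hyw'⟩ := exists_cyl_of_mem_limitSet hy.2 (n + 1)
      have hne : w ≠ w' := by
        rintro rfl
        exact hyw hyw'
      obtain ⟨u', hu', hsub', hle⟩ := G.child_of_mem_words hw
      obtain rfl := G.eq_of_mem_cyl hu hu' (hsub hx) (hsub' hxw)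
      refine ⟨n, u, hu, hsub, Or.inr ?_⟩
      have h1 := G.dist_ge_of_ne hw hw' hne hxw hyw'
      have h2 : |x - y| ≤ Metric.diam U := Metric.dist_le_diam_of_mem hb hx.1 hy.1
      have hδ := G.δ_pos
      have hθ := G.θ_pos
      rw [le_inv_mul_iff₀ (by positivity), mul_assoc]
      exact (mul_le_mul_of_nonneg_left hle hδ.le).trans (h1.trans h2)

/-- A finite cover of the limit set by cylinders carries a definite amount of mass. -/
lemma sum_rpow_ge_of_finite_cover {c : ℕ → Fin k} {s c₀ : ℝ} (hc₀ : 0 < c₀)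
    (hZ : ∀ n, c₀ ≤ partSum F c n s) {ι : Type*} (T : Finset ι) (m : ι → ℕ)
    (u : ι → List (Letter F)) (hu : ∀ i ∈ T, u i ∈ words F c (m i))
    (hcov : limitSet F c ⊆ ⋃ i ∈ T, cyl F (u i)) :
    c₀ ≤ (G.B ^ |s|) ^ 2 * ∑ i ∈ T, len F (u i) ^ s := by
  classical
  -- All covering cylinders are refined to the common level M, where every word descends from some
  -- `u i`. The descendants of `u i` contribute at most D² len(u i)^s Z_M / c₀; summing over i and
  -- cancelling Z_M gives the claim without constructing a measure.
  set M := T.sup m with hM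
  have hmM : ∀ i ∈ T, m i ≤ M := fun i hi => Finset.le_sup hi
  set D := G.B ^ |s| with hD
  have hD0 : 0 < D := Real.rpow_pos_of_pos G.B_pos _
  have hpos := G.partSum_pos c M s
  have hnn : ∀ w, 0 ≤ len F w ^ s := fun w => Real.rpow_nonneg (G.len_pos w).le s
  have h1 : partSum F c M s ≤ ∑ i ∈ T, ∑ v ∈ words F (fun l => c (m i + l)) (M - m i),
      len F (u i ++ v) ^ s := by
    have hsub : words F c M ⊆ T.biUnion fun i =>
        (words F (fun l => c (m i + l)) (M - m i)).image (u i ++ ·) := by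
      intro w hw
      obtain ⟨x, hx, hxw⟩ := G.exists_mem_limitSet_cyl hw
      obtain ⟨i, hi, hxi⟩ := mem_iUnion₂.1 (hcov hx)
      have hw' := hw
      rw [← Nat.add_sub_cancel' (hmM i hi)] at hw'
      obtain ⟨u', hu', v, hv, rfl⟩ := exists_append_of_mem_words hw'
      obtain rfl := G.eq_of_mem_cyl (hu i hi) hu' hxi (cyl_append_subset F _ v hxw)
      exact Finset.mem_biUnion.2 ⟨i, hi, Finset.mem_image_of_mem _ hv⟩
    calc partSum F c M s ≤ ∑ w ∈ T.biUnion fun i =>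
          (words F (fun l => c (m i + l)) (M - m i)).image (u i ++ ·), len F w ^ s :=
          Finset.sum_le_sum_of_subset_of_nonneg hsub fun w _ _ => hnn w
      _ ≤ ∑ i ∈ T, ∑ w ∈ (words F (fun l => c (m i + l)) (M - m i)).image (u i ++ ·),
          len F w ^ s := by
          exact Finset.sum_biUnion_le_sum_sum hnn T _
      _ = _ := Finset.sum_congr rfl fun i _ =>
          Finset.sum_image fun v _ v' _ h => List.append_cancel_left h
  have h2 : ∀ i ∈ T, ∑ v ∈ words F (fun l => c (m i + l)) (M - m i), len F (u i ++ v) ^ s ≤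
      D ^ 2 * len F (u i) ^ s * (partSum F c M s / c₀) := by
    intro i hi
    have h3 : c₀ * partSum F (fun l => c (m i + l)) (M - m i) s ≤ D * partSum F c M s := by
      have h := G.mul_le_partSum_add c (m i) (M - m i) s
      rw [Nat.add_sub_cancel' (hmM i hi)] at h
      refine le_trans ?_ h
      have := (G.partSum_pos (fun l => c (m i + l)) (M - m i) s).le
      gcongr
      exact hZ _
    calc _ ≤ ∑ v ∈ words F (fun l => c (m i + l)) (M - m i),
          D * (len F (u i) ^ s * len F v ^ s) :=
          Finset.sum_le_sum fun v _ => G.rpow_len_append_le _ v s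
      _ = D * len F (u i) ^ s * partSum F (fun l => c (m i + l)) (M - m i) s := by
          rw [partSum, Finset.mul_sum]
          exact Finset.sum_congr rfl fun v _ => by ring
      _ ≤ D * len F (u i) ^ s * (D * partSum F c M s / c₀) := by
          have := hnn (u i)
          gcongr
          rwa [le_div_iff₀' hc₀]
      _ = _ := by ring
  have h3 := h1.trans (Finset.sum_le_sum h2)
  rw [← Finset.sum_mul, ← Finset.mul_sum, mul_div_assoc', le_div_iff₀ hc₀, mul_comm] at h3
  exact le_of_mul_le_mul_right h3 hpos

end Geometry

end CookieCutter

/-! ### Hausdorff dimension. -/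

namespace CookieCutter

variable {a b : ℝ} {τ : ℝ≥0} {k : ℕ} {F : Fin k → CookieCutter a b τ}

lemma ediam_cyl (w : List (Letter F)) : Metric.ediam (cyl F w) = ENNReal.ofReal (len F w) :=
  (ENNReal.ofReal_toReal (isBounded_cyl F w).ediam_ne_top).symm

namespace Geometry

variable (G : Geometry F)
include G

/-- Hausdorff measure is bounded by a liminf over covers of vanishing mesh, so good levels need only
occur infinitely often. -/
theorem dimH_limitSet_le {c : ℕ → Fin k} {s : ℝ≥0}
    (h : ∃ᶠ n in atTop, partSum F c n s ≤ 1) : dimH (limitSet F c) ≤ s := by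
  refine dimH_le_of_hausdorffMeasure_ne_top (ne_top_of_le_ne_top ENNReal.one_ne_top ?_)
  refine (MeasureTheory.Measure.hausdorffMeasure_le_liminf_sum (ι := fun n => words F c n)
    (s : ℝ) (limitSet F c) (l := atTop) (fun n => ENNReal.ofReal (G.ρ ^ n * (b - a))) ?_
    (fun n w => cyl F w.1) ?_ ?_).trans ?_
  · rw [← ENNReal.ofReal_zero]
    exact ENNReal.tendsto_ofReal G.tendsto_pow_mul_sub
  · refine Eventually.of_forall fun n w => ?_
    rw [ediam_cyl]
    exact ENNReal.ofReal_le_ofReal (G.len_le_of_mem_words w.2)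
  · refine Eventually.of_forall fun n x hx => ?_
    obtain ⟨w, hw, hxw⟩ := exists_cyl_of_mem_limitSet hx n
    exact mem_iUnion.2 ⟨⟨w, hw⟩, hxw⟩
  · refine liminf_le_of_frequently_le ?_
    refine h.mono fun n hn => ?_
    rw [Finset.sum_coe_sort (words F c n) fun w => Metric.ediam (cyl F w) ^ (s : ℝ)]
    calc _ = ∑ w ∈ words F c n, ENNReal.ofReal (len F w ^ (s : ℝ)) :=
          Finset.sum_congr rfl fun w _ => by
            rw [ediam_cyl, ENNReal.ofReal_rpow_of_pos (G.len_pos w)]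
      _ = ENNReal.ofReal (partSum F c n s) :=
          (ENNReal.ofReal_sum_of_nonneg fun w _ => Real.rpow_nonneg (G.len_pos w).le _).symm
      _ ≤ 1 := by simpa using hn

/-- The limit set is covered by finitely many members of any countable family of cylinders
covering it. -/
lemma exists_finite_subcover {c : ℕ → Fin k} {ι : Type*} (m : ι → ℕ) (u : ι → List (Letter F))
    (hu : ∀ i, u i ∈ words F c (m i)) (hcov : limitSet F c ⊆ ⋃ i, cyl F (u i)) :
    ∃ T : Finset ι, limitSet F c ⊆ ⋃ i ∈ T, cyl F (u i) := by
  classical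
  -- Cylinders are relatively open in the limit set: removing the finitely many other compact
  -- cylinders of the same level leaves an open set.
  obtain ⟨T, hT⟩ := (G.isCompact_limitSet c).elim_finite_subcover
    (fun i => (⋃ w ∈ (words F c (m i)).erase (u i), cyl F w)ᶜ)
    (fun i => (((words F c (m i)).erase (u i)).isCompact_biUnion
      fun w _ => G.isCompact_cyl w).isClosed.isOpen_compl)
    (fun x hx => by
      obtain ⟨i, hi⟩ := mem_iUnion.1 (hcov hx)
      refine mem_iUnion.2 ⟨i, fun h => ?_⟩
      obtain ⟨w, hw, hxw⟩ := mem_iUnion₂.1 h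
      exact (Finset.ne_of_mem_erase hw)
        (G.eq_of_mem_cyl (Finset.mem_of_mem_erase hw) (hu i) hxw hi))
  refine ⟨T, fun x hx => ?_⟩
  obtain ⟨i, hi, hxi⟩ := mem_iUnion₂.1 (hT hx)
  refine mem_iUnion₂.2 ⟨i, hi, ?_⟩
  obtain ⟨w, hw, hxw⟩ := exists_cyl_of_mem_limitSet hx (m i)
  by_cases he : w = u i
  · exact he ▸ hxw
  · exact absurd (mem_iUnion₂.2 ⟨w, Finset.mem_erase.2 ⟨he, hw⟩, hxw⟩) hxi

theorem le_dimH_limitSet {c : ℕ → Fin k} {s : ℝ≥0} (hs : 0 < s) {c₀ : ℝ} (hc₀ : 0 < c₀)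
    (hZ : ∀ n, c₀ ≤ partSum F c n s) : (s : ℝ≥0∞) ≤ dimH (limitSet F c) := by
  refine le_dimH_of_hausdorffMeasure_ne_zero fun h0 => ?_
  have hs' : (0 : ℝ) < s := hs
  set K := (G.δ * G.θ)⁻¹ with hK
  have hK0 : 0 < K := inv_pos.2 (mul_pos G.δ_pos G.θ_pos)
  set D := (G.B ^ |(s : ℝ)|) ^ 2 with hD
  have hD0 : 0 < D := by
    have := Real.rpow_pos_of_pos G.B_pos |(s : ℝ)|
    positivity
  -- Chosen so that D(K^s ε + ε) = c₀, contradicting the strict bound obtained at the end.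
  set ε : ℝ := c₀ / (D * (K ^ (s : ℝ) + 1)) with hε
  have hε0 : 0 < ε := by positivity
  have hinf : (⨅ (t : ℕ → Set ℝ) (_ : limitSet F c ⊆ ⋃ n, t n)
      (_ : ∀ n, Metric.ediam (t n) ≤ 1),
      ∑' n, ⨆ _ : (t n).Nonempty, Metric.ediam (t n) ^ (s : ℝ)) < ENNReal.ofReal ε := by
    rw [MeasureTheory.Measure.hausdorffMeasure_apply] at h0
    refine lt_of_le_of_lt ?_ (ENNReal.ofReal_pos.2 hε0)
    rw [← h0]
    exact le_iSup₂ (f := fun (r : ℝ≥0∞) (_ : 0 < r) => ⨅ (t : ℕ → Set ℝ)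
      (_ : limitSet F c ⊆ ⋃ n, t n) (_ : ∀ n, Metric.ediam (t n) ≤ r),
      ∑' n, ⨆ _ : (t n).Nonempty, Metric.ediam (t n) ^ (s : ℝ)) 1 one_pos
  simp only [iInf_lt_iff] at hinf
  obtain ⟨t, htcov, htd, hsum⟩ := hinf
  -- A summable budget below ε pays for the sets whose cylinder is merely small rather than
  -- comparable to them.
  obtain ⟨e, he0, e', he, hee⟩ := NNReal.exists_pos_sum_of_countable
    (Real.toNNReal_pos.2 hε0).ne' ℕ
  have hfin : ∀ n, Metric.ediam (t n) ≠ ⊤ := fun n =>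
    ne_top_of_le_ne_top ENNReal.one_ne_top (htd n)
  choose m u hu hsub hlen using fun i : {n // (t n ∩ limitSet F c).Nonempty} =>
    G.exists_cyl_superset c i.2 (Metric.isBounded_iff_ediam_ne_top.2 (hfin i))
      (ε := (e i : ℝ) ^ (1 / (s : ℝ))) (Real.rpow_pos_of_pos (he0 i) _)
  obtain ⟨T, hT⟩ := G.exists_finite_subcover m u hu fun x hx => by
    obtain ⟨n, hn⟩ := mem_iUnion.1 (htcov hx)
    exact mem_iUnion.2 ⟨⟨n, x, hn, hx⟩, hsub _ ⟨hn, hx⟩⟩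
  have hmass := G.sum_rpow_ge_of_finite_cover hc₀ hZ T m u (fun i _ => hu i) hT
  have hterm : ∀ i ∈ T, len F (u i) ^ (s : ℝ) ≤
      K ^ (s : ℝ) * Metric.diam (t i) ^ (s : ℝ) + e i := by
    intro i _
    have hd : 0 ≤ Metric.diam (t i) := Metric.diam_nonneg
    have hp := (G.len_pos (u i)).le
    rcases hlen i with h | h
    · have h1 := Real.rpow_le_rpow hp h hs'.le
      rw [← Real.rpow_mul (e i).coe_nonneg, one_div_mul_cancel hs'.ne', Real.rpow_one] at h1
      have : 0 ≤ K ^ (s : ℝ) * Metric.diam (t i) ^ (s : ℝ) := by positivity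
      linarith
    · have h1 := Real.rpow_le_rpow hp h hs'.le
      rw [Real.mul_rpow hK0.le hd] at h1
      have : (0 : ℝ) ≤ e i := (e i).coe_nonneg
      linarith
  have hsum1 : ∑ i ∈ T, Metric.diam (t i) ^ (s : ℝ) < ε := by
    rw [← ENNReal.ofReal_lt_ofReal_iff hε0]
    refine lt_of_le_of_lt ?_ hsum
    rw [ENNReal.ofReal_sum_of_nonneg fun i _ => Real.rpow_nonneg Metric.diam_nonneg _]
    calc _ ≤ ∑ i ∈ T, ⨆ _ : (t i).Nonempty, Metric.ediam (t i) ^ (s : ℝ) := by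
          refine Finset.sum_le_sum fun i _ => ?_
          rw [ciSup_pos i.2.left, ← ENNReal.ofReal_rpow_of_nonneg Metric.diam_nonneg hs'.le,
            Metric.diam, ENNReal.ofReal_toReal (hfin i)]
      _ ≤ _ := ENNReal.sum_le_tsum T
      _ ≤ _ := ENNReal.tsum_comp_le_tsum_of_injective Subtype.val_injective
          fun n => ⨆ _ : (t n).Nonempty, Metric.ediam (t n) ^ (s : ℝ)
  have hsum2 : ∑ i ∈ T, (e i : ℝ) ≤ ε := by
    have h1 : ∑ i ∈ T, e i ≤ e' := by
      rw [← he.tsum_eq]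
      calc ∑ i ∈ T, e i = ∑ n ∈ T.map (Function.Embedding.subtype _), e n := by simp
        _ ≤ _ := he.summable.sum_le_tsum _ fun _ _ => zero_le
    have h2 := (Real.lt_toNNReal_iff_coe_lt.1 (h1.trans_lt hee)).le
    exact_mod_cast h2
  have hfinal : ∑ i ∈ T, len F (u i) ^ (s : ℝ) < K ^ (s : ℝ) * ε + ε := by
    refine (Finset.sum_le_sum hterm).trans_lt ?_
    rw [Finset.sum_add_distrib, ← Finset.mul_sum]
    have := mul_lt_mul_of_pos_left hsum1 (Real.rpow_pos_of_pos hK0 (s : ℝ))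
    linarith
  have hlt := hmass.trans_lt (mul_lt_mul_of_pos_left hfinal hD0)
  have : D * (K ^ (s : ℝ) * ε + ε) = c₀ := by
    rw [hε]
    field_simp
  linarith

end Geometry

end CookieCutter

/-! ### Upper box-counting dimension. -/

lemma log_covering_div_le_iff {X : Type*} [PseudoEMetricSpace X] {A : Set X} {ε : ℝ≥0}
    (h0 : 0 < ε) (h1 : ε < 1) (s : ℝ) :
    ENNReal.log ((Metric.externalCoveringNumber ε A : ℕ∞) : ℝ≥0∞) /
        ((-Real.log (ε : ℝ) : ℝ) : EReal) ≤ s ↔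
      ((Metric.externalCoveringNumber ε A : ℕ∞) : ℝ≥0∞) ≤ ENNReal.ofReal ((ε : ℝ) ^ (-s)) := by
  have hε : (0 : ℝ) < ε := h0
  have hL : 0 < -Real.log (ε : ℝ) := neg_pos.2 (Real.log_neg hε (by exact_mod_cast h1))
  rw [EReal.div_le_iff_le_mul (by exact_mod_cast hL) (EReal.coe_ne_top _), ← EReal.coe_mul,
    ← ENNReal.log_le_log_iff, ENNReal.log_ofReal_of_pos (Real.rpow_pos_of_pos hε _),
    Real.log_rpow hε, show -Real.log (ε : ℝ) * s = -s * Real.log ε by ring]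

lemma eventually_pos_lt_one : ∀ᶠ ε : ℝ≥0 in 𝓝[>] 0, 0 < ε ∧ ε < 1 := by
  filter_upwards [self_mem_nhdsWithin, mem_nhdsWithin_of_mem_nhds (Iio_mem_nhds one_pos)]
    with ε h0 h1
  exact ⟨h0, h1⟩

lemma upperBoxDim_le_of_eventually {X : Type*} [PseudoEMetricSpace X] {A : Set X} {s : ℝ}
    (h : ∀ᶠ ε : ℝ≥0 in 𝓝[>] 0, ((Metric.externalCoveringNumber ε A : ℕ∞) : ℝ≥0∞) ≤
      ENNReal.ofReal ((ε : ℝ) ^ (-s))) : upperBoxDim A ≤ s := by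
  refine limsup_le_of_le (by isBoundedDefault) ?_
  filter_upwards [h, eventually_pos_lt_one] with ε h hε
  exact (log_covering_div_le_iff hε.1 hε.2 s).2 h

lemma eventually_covering_le_of_upperBoxDim_lt {X : Type*} [PseudoEMetricSpace X] {A : Set X}
    {s : ℝ} (h : upperBoxDim A < s) :
    ∀ᶠ ε : ℝ≥0 in 𝓝[>] 0, ((Metric.externalCoveringNumber ε A : ℕ∞) : ℝ≥0∞) ≤
      ENNReal.ofReal ((ε : ℝ) ^ (-s)) := by
  filter_upwards [eventually_lt_of_limsup_lt h, eventually_pos_lt_one] with ε h hε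
  exact (log_covering_div_le_iff hε.1 hε.2 s).1 h.le

lemma upperBoxDim_nonneg {X : Type*} [PseudoEMetricSpace X] {A : Set X} (hA : A.Nonempty) :
    0 ≤ upperBoxDim A := by
  refine le_limsup_of_frequently_le (Eventually.frequently ?_) (by isBoundedDefault)
  filter_upwards [eventually_pos_lt_one] with ε hε
  have h1 : (1 : ℝ≥0∞) ≤ ((Metric.externalCoveringNumber ε A : ℕ∞) : ℝ≥0∞) := by
    exact_mod_cast Order.one_le_iff_pos.2 (Metric.externalCoveringNumber_pos_iff.2 hA)
  have hL : 0 ≤ -Real.log (ε : ℝ) :=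
    neg_nonneg.2 (Real.log_nonpos ε.coe_nonneg (by exact_mod_cast hε.2.le))
  exact EReal.div_nonneg (ENNReal.zero_le_log_iff.2 h1) (by exact_mod_cast hL)

namespace CookieCutter

variable {a b : ℝ} {τ : ℝ≥0} {k : ℕ} {F : Fin k → CookieCutter a b τ}

namespace Geometry

variable (G : Geometry F)
include G

/-- Every point of the limit set lies in a cylinder of size comparable to a given scale. -/
lemma exists_cyl_of_scale {c : ℕ → Fin k} {x : ℝ} (hx : x ∈ limitSet F c) {ε : ℝ} (hε : 0 < ε)
    (hε' : ε < b - a) :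
    ∃ n, ∃ w ∈ words F c n, x ∈ cyl F w ∧ G.θ * ε ≤ len F w ∧ len F w ≤ ε := by
  classical
  have hex : ∃ n, ∃ w ∈ words F c n, x ∈ cyl F w ∧ len F w ≤ ε := by
    obtain ⟨n, hn⟩ := (G.tendsto_pow_mul_sub.eventually_lt_const hε).exists
    obtain ⟨w, hw, hxw⟩ := exists_cyl_of_mem_limitSet hx n
    exact ⟨n, w, hw, hxw, (G.len_le_of_mem_words hw).trans hn.le⟩
  obtain ⟨w, hw, hxw, hle⟩ := Nat.find_spec hex
  rcases hn : Nat.find hex with _ | n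
  · rw [hn] at hw
    rw [mem_words_zero.1 hw, len, cyl_nil, Real.diam_Icc G.hab.le] at hle
    exact absurd hle (not_le.2 hε')
  · rw [hn] at hw
    obtain ⟨u, hu, hsub, hc⟩ := G.child_of_mem_words hw
    have hmin := Nat.find_min hex (m := n) (by omega)
    push Not at hmin
    have := G.θ_pos
    exact ⟨n + 1, w, hw, hxw, le_trans (by gcongr; exact (hmin u hu (hsub hxw)).le) hc, hle⟩

lemma externalCoveringNumber_le {c : ℕ → Fin k} {s : ℝ} (hs : 0 ≤ s)
    (hsum : Summable fun n => partSum F c n s) {ε : ℝ≥0} (hε : 0 < ε) (hε' : (ε : ℝ) < b - a) :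
    ((Metric.externalCoveringNumber ε (limitSet F c) : ℕ∞) : ℝ≥0∞) ≤
      ENNReal.ofReal ((∑' n, partSum F c n s) * (G.θ * ε) ^ (-s)) := by
  classical
  have hε0 : (0 : ℝ) < ε := hε
  have hθε : 0 < G.θ * ε := mul_pos G.θ_pos hε0
  -- From level M on, cylinders are shorter than θε, so finitely many words suffice. Each selected
  -- word contributes at least (θε)^s to ∑ Z_n(s).
  obtain ⟨M, hM⟩ := eventually_atTop.1 (G.tendsto_pow_mul_sub.eventually_lt_const hθε)
  set W := (Finset.range M).biUnion fun n => (words F c n).filter fun w => G.θ * ε ≤ len F w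
    with hW
  have hcover : Metric.IsCover ε (limitSet F c)
      (W.image fun w => wordMap F w a : Finset ℝ) := by
    rw [Metric.isCover_iff_subset_iUnion_closedBall]
    intro x hx
    obtain ⟨n, w, hw, hxw, h1, h2⟩ := G.exists_cyl_of_scale hx hε0 hε'
    have hn : n < M := by
      by_contra h
      have := hM n (not_lt.1 h)
      linarith [G.len_le_of_mem_words hw]
    have hwW : w ∈ W := Finset.mem_biUnion.2
      ⟨n, Finset.mem_range.2 hn, Finset.mem_filter.2 ⟨hw, h1⟩⟩
    refine mem_iUnion₂.2 ⟨_, Finset.mem_coe.2 (Finset.mem_image_of_mem _ hwW), ?_⟩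
    rw [Metric.mem_closedBall, Real.dist_eq]
    exact (abs_sub_le_len hxw (mem_image_of_mem _ (left_mem_Icc.2 G.hab.le))).trans h2
  have hcard : (W.card : ℝ) * (G.θ * ε) ^ s ≤ ∑' n, partSum F c n s := by
    have hnn : ∀ w, 0 ≤ len F w ^ s := fun w => Real.rpow_nonneg (G.len_pos w).le s
    calc (W.card : ℝ) * (G.θ * ε) ^ s = ∑ w ∈ W, (G.θ * ε) ^ s := by simp
      _ ≤ ∑ w ∈ W, len F w ^ s := by
          refine Finset.sum_le_sum fun w hw => ?_
          obtain ⟨n, -, hn⟩ := Finset.mem_biUnion.1 hw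
          exact Real.rpow_le_rpow hθε.le (Finset.mem_filter.1 hn).2 hs
      _ ≤ ∑ n ∈ Finset.range M, ∑ w ∈ (words F c n).filter fun w => G.θ * ε ≤ len F w,
            len F w ^ s := Finset.sum_biUnion_le_sum_sum hnn _ _
      _ ≤ ∑ n ∈ Finset.range M, partSum F c n s := by
          refine Finset.sum_le_sum fun n _ => ?_
          exact Finset.sum_le_sum_of_subset_of_nonneg (Finset.filter_subset _ _)
            fun w _ _ => hnn w
      _ ≤ _ := hsum.sum_le_tsum _ fun n _ => (G.partSum_pos c n s).le
  have h1 : ((Metric.externalCoveringNumber ε (limitSet F c) : ℕ∞) : ℝ≥0∞) ≤ (W.card : ℝ≥0∞) := by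
    have h := hcover.externalCoveringNumber_le_encard
    rw [Set.encard_coe_eq_coe_finsetCard] at h
    have h' := h.trans (Nat.cast_le.2 (Finset.card_image_le (s := W) (f := fun w => wordMap F w a)))
    exact_mod_cast (ENat.toENNReal_le.2 h')
  refine h1.trans ?_
  rw [← ENNReal.ofReal_natCast]
  refine ENNReal.ofReal_le_ofReal ?_
  rw [Real.rpow_neg hθε.le, ← div_eq_mul_inv, le_div_iff₀ (Real.rpow_pos_of_pos hθε s)]
  exact hcard

theorem upperBoxDim_limitSet_le {c : ℕ → Fin k} {s t : ℝ} (hs : 0 ≤ s) (hst : s < t)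
    (hsum : Summable fun n => partSum F c n s) : upperBoxDim (limitSet F c) ≤ t := by
  refine upperBoxDim_le_of_eventually ?_
  set S := (∑' n, partSum F c n s) * G.θ ^ (-s) with hS
  have hS0 : 0 < S := mul_pos
    (hsum.tsum_pos (fun n => (G.partSum_pos c n s).le) 0 (G.partSum_pos c 0 s))
    (Real.rpow_pos_of_pos G.θ_pos _)
  have hlim : Tendsto (fun ε : ℝ≥0 => S * (ε : ℝ) ^ (t - s)) (𝓝[>] 0) (𝓝 0) := by
    have h : Continuous fun ε : ℝ≥0 => S * (ε : ℝ) ^ (t - s) := by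
      have := (sub_pos.2 hst).le
      exact continuous_const.mul (NNReal.continuous_coe.rpow_const fun _ => Or.inr this)
    have h' := (h.tendsto 0).mono_left (nhdsWithin_le_nhds (s := Ioi 0))
    simpa [Real.zero_rpow (sub_pos.2 hst).ne'] using h'
  have hsmall : ∀ᶠ ε : ℝ≥0 in 𝓝[>] 0, (ε : ℝ) < b - a := by
    have h : Tendsto (fun ε : ℝ≥0 => (ε : ℝ)) (𝓝[>] 0) (𝓝 0) :=
      (NNReal.continuous_coe.tendsto 0).mono_left nhdsWithin_le_nhds
    exact h.eventually_lt_const G.interval_length_pos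
  filter_upwards [hlim.eventually_lt_const one_pos, hsmall, self_mem_nhdsWithin] with ε h1 h2 h3
  have hε : (0 : ℝ) < ε := h3
  refine (G.externalCoveringNumber_le hs hsum h3 h2).trans (ENNReal.ofReal_le_ofReal ?_)
  calc _ = (S * (ε : ℝ) ^ (t - s)) * (ε : ℝ) ^ (-t) := by
        rw [hS, Real.mul_rpow G.θ_pos.le hε.le, mul_assoc (_ * _), ← Real.rpow_add hε]
        ring_nf
    _ ≤ 1 * (ε : ℝ) ^ (-t) := by gcongr
    _ = _ := one_mul _

/-- One limit point per long cylinder gives points at distance at least 3ε, hence strictly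
2ε-separated, and a 2ε-packing is no larger than any ε-cover. -/
lemma card_filter_le_externalCoveringNumber (c : ℕ → Fin k) (n : ℕ) {ε : ℝ≥0} (hε : 0 < ε) :
    (((words F c n).filter fun w => 3 * ε / G.δ ≤ len F w).card : ℝ≥0∞) ≤
      ((Metric.externalCoveringNumber ε (limitSet F c) : ℕ∞) : ℝ≥0∞) := by
  classical
  set W := (words F c n).filter fun w => 3 * ε / G.δ ≤ len F w with hW
  have hε0 : (0 : ℝ) < ε := hε
  choose! p hpJ hp using fun (w : List (Letter F)) (hw : w ∈ words F c n) =>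
    G.exists_mem_limitSet_cyl hw
  have hmem : ∀ {w}, w ∈ W → w ∈ words F c n := fun h => (Finset.mem_filter.1 h).1
  have hdist : ∀ w ∈ W, ∀ w' ∈ W, w ≠ w' → 3 * ε ≤ |p w - p w'| := fun w hw w' hw' hne => by
    have h1 := G.dist_ge_of_ne (hmem hw) (hmem hw') hne (hp w (hmem hw)) (hp w' (hmem hw'))
    have h2 := (div_le_iff₀' G.δ_pos).1 (Finset.mem_filter.1 hw).2
    exact h2.trans h1
  have hinj : InjOn p W := fun w hw w' hw' he => by
    by_contra hne
    have := hdist w hw w' hw' hne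
    rw [he, sub_self, abs_zero] at this
    linarith
  have hsep : Metric.IsSeparated ((2 * ε : ℝ≥0) : ℝ≥0∞) (p '' (W : Set (List (Letter F)))) := by
    rintro _ ⟨w, hw, rfl⟩ _ ⟨w', hw', rfl⟩ hne
    have h := hdist w hw w' hw' (fun h => hne (h ▸ rfl))
    rw [edist_dist, Real.dist_eq, ← ENNReal.ofReal_coe_nnreal]
    refine (ENNReal.ofReal_lt_ofReal_iff (by linarith)).2 ?_
    push_cast
    linarith
  have hsub : p '' (W : Set (List (Letter F))) ⊆ limitSet F c := by
    rintro _ ⟨w, hw, rfl⟩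
    exact hpJ w (hmem hw)
  have h := (hsep.encard_le_packingNumber hsub).trans
    (Metric.packingNumber_two_mul_le_externalCoveringNumber ε (limitSet F c))
  rw [hinj.encard_image, Set.encard_coe_eq_coe_finsetCard] at h
  exact_mod_cast (ENat.toENNReal_le.2 h)

/-- If the covering numbers grow at most like `ε ^ (-t)` and `t < s`, then the partition functions
at `s` are bounded. -/
lemma exists_partSum_le_of_covering_le {c : ℕ → Fin k} {s t : ℝ} (hs : 0 ≤ s) (hts : t < s)
    (h : ∀ᶠ ε : ℝ≥0 in 𝓝[>] 0,
      ((Metric.externalCoveringNumber ε (limitSet F c) : ℕ∞) : ℝ≥0∞) ≤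
        ENNReal.ofReal ((ε : ℝ) ^ (-t))) :
    ∃ K, ∀ᶠ n in atTop, partSum F c n s ≤ K := by
  classical
  obtain ⟨ε₀, hε₀, hcov⟩ := (mem_nhdsGT_iff_exists_Ioo_subset' (one_pos)).1 h
  have hε₀' : (0 : ℝ) < ε₀ := hε₀
  have hδ := G.δ_pos
  have hcard : ∀ (n : ℕ) (r : ℝ), 0 < r → G.δ * r / 3 < ε₀ →
      (((words F c n).filter fun w => r ≤ len F w).card : ℝ) ≤ (G.δ * r / 3) ^ (-t) := by
    intro n r hr hr'
    have hε : 0 < G.δ * r / 3 := by positivity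
    have h1 := G.card_filter_le_externalCoveringNumber c n (ε := (G.δ * r / 3).toNNReal)
      (Real.toNNReal_pos.2 hε)
    have h2 := hcov (a := (G.δ * r / 3).toNNReal)
      ⟨Real.toNNReal_pos.2 hε, (Real.toNNReal_lt_iff_lt_coe hε.le).2 hr'⟩
    have h3 := h1.trans h2
    rw [Real.coe_toNNReal _ hε.le, ← ENNReal.ofReal_natCast,
      ENNReal.ofReal_le_ofReal_iff (by positivity),
      show 3 * (G.δ * r / 3) / G.δ = r by field_simp] at h3
    exact h3
  set q : ℝ := (2⁻¹ : ℝ) ^ (s - t) with hq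
  have hq0 : 0 ≤ q := by positivity
  have hq1 : q < 1 := Real.rpow_lt_one (by norm_num) (by norm_num) (sub_pos.2 hts)
  set C : ℝ := (G.δ * 2⁻¹ / 3) ^ (-t) with hC
  have hC0 : 0 ≤ C := by positivity
  refine ⟨C * (1 - q)⁻¹, ?_⟩
  -- For large n every cylinder is short enough for the covering bound to apply at its scale, and
  -- has length at most 1, so a dyadic exponent exists.
  filter_upwards [G.tendsto_pow_mul_sub.eventually_lt_const
    (lt_min one_pos (show 0 < 3 * ε₀ / G.δ by positivity))] with n hn
  have hlen : ∀ w ∈ words F c n, len F w ≤ 1 ∧ G.δ * len F w / 3 < ε₀ := fun w hw => by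
    have h1 := (G.len_le_of_mem_words hw).trans_lt hn
    refine ⟨(h1.trans_le (min_le_left _ _)).le, ?_⟩
    have h2 := (lt_div_iff₀' hδ).1 (h1.trans_le (min_le_right _ _))
    linarith
  -- Words are sorted by dyadic length. About 2^(lt) of them at most have length near 2^(-l), each
  -- contributing at most 2^(-ls); the resulting geometric series has ratio q < 1.
  choose! κ hκ₁ hκ₂ using fun (w : List (Letter F)) (hw : w ∈ words F c n) =>
    exists_nat_pow_near_of_lt_one (G.len_pos w) (hlen w hw).1
      (show (0 : ℝ) < 2⁻¹ by norm_num) (by norm_num)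
  have hlevel : ∀ l : ℕ, ∑ w ∈ (words F c n).filter (fun w => κ w = l), len F w ^ s ≤
      C * q ^ l := by
    intro l
    rcases ((words F c n).filter fun w => κ w = l).eq_empty_or_nonempty with he | ⟨w₀, hw₀⟩
    · rw [he, Finset.sum_empty]
      positivity
    · obtain ⟨hw₀, hl⟩ := Finset.mem_filter.1 hw₀
      have hr : (0 : ℝ) < 2⁻¹ ^ (l + 1) := by positivity
      have h1 := hcard n (2⁻¹ ^ (l + 1)) hr (by
        refine lt_of_le_of_lt ?_ (hlen w₀ hw₀).2
        have := (hκ₁ w₀ hw₀).le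
        rw [hl] at this
        gcongr)
      calc ∑ w ∈ (words F c n).filter (fun w => κ w = l), len F w ^ s
          ≤ ∑ w ∈ (words F c n).filter (fun w => κ w = l), ((2⁻¹ : ℝ) ^ l) ^ s := by
            refine Finset.sum_le_sum fun w hw => ?_
            obtain ⟨hw, hw'⟩ := Finset.mem_filter.1 hw
            have := hκ₂ w hw
            rw [hw'] at this
            exact Real.rpow_le_rpow (G.len_pos w).le this hs
        _ = ((words F c n).filter (fun w => κ w = l)).card * ((2⁻¹ : ℝ) ^ l) ^ s := by simp
        _ ≤ ((words F c n).filter (fun w => (2⁻¹ : ℝ) ^ (l + 1) ≤ len F w)).card *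
              ((2⁻¹ : ℝ) ^ l) ^ s := by
            gcongr with w hw
            intro hw'
            have := (hκ₁ w hw).le
            rwa [hw'] at this
        _ ≤ (G.δ * 2⁻¹ ^ (l + 1) / 3) ^ (-t) * ((2⁻¹ : ℝ) ^ l) ^ s := by gcongr
        _ = C * q ^ l := by
            have h2 : (0 : ℝ) < 2⁻¹ ^ l := by positivity
            rw [show G.δ * (2⁻¹ : ℝ) ^ (l + 1) / 3 = (G.δ * 2⁻¹ / 3) * 2⁻¹ ^ l by ring,
              Real.mul_rpow (by positivity) h2.le, mul_assoc, ← Real.rpow_add h2, hq,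
              ← Real.rpow_natCast, ← Real.rpow_natCast, ← Real.rpow_mul (by norm_num),
              ← Real.rpow_mul (by norm_num), ← hC,
              show (l : ℝ) * (-t + s) = (s - t) * l by ring]
  calc partSum F c n s = ∑ l ∈ (words F c n).image κ,
        ∑ w ∈ (words F c n).filter (fun w => κ w = l), len F w ^ s :=
        (Finset.sum_fiberwise_of_maps_to (fun w hw => Finset.mem_image_of_mem κ hw) _).symm
    _ ≤ ∑ l ∈ (words F c n).image κ, C * q ^ l := Finset.sum_le_sum fun l _ => hlevel l
    _ = C * ∑ l ∈ (words F c n).image κ, q ^ l := by rw [Finset.mul_sum]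
    _ ≤ C * (1 - q)⁻¹ := by
        gcongr
        rw [← tsum_geometric_of_lt_one hq0 hq1]
        exact (summable_geometric_of_lt_one hq0 hq1).sum_le_tsum _ fun _ _ => by positivity

end Geometry

end CookieCutter

/-! ### The dimension formulae. -/

lemma exists_pos_forall_le_of_eventually {u : ℕ → ℝ} (hpos : ∀ n, 0 < u n)
    (h : ∀ᶠ n in atTop, 1 ≤ u n) : ∃ c₀, 0 < c₀ ∧ ∀ n, c₀ ≤ u n := by
  obtain ⟨N, hN⟩ := eventually_atTop.1 h
  obtain ⟨m, -, hm⟩ := Finset.exists_min_image (Finset.range (N + 1)) u ⟨0, by simp⟩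
  refine ⟨min 1 (u m), lt_min one_pos (hpos m), fun n => ?_⟩
  rcases le_or_gt N n with hn | hn
  · exact (min_le_left _ _).trans (hN n hn)
  · exact (min_le_right _ _).trans (hm n (Finset.mem_range.2 (by omega)))

namespace CookieCutter

variable {a b : ℝ} {τ : ℝ≥0} {k : ℕ} {F : Fin k → CookieCutter a b τ}

namespace Geometry

variable (G : Geometry F)
include G

lemma eventually_root_freq_nonneg (c : ℕ → Fin k) :
    ∀ᶠ n in atTop, 0 ≤ root F (freq c n) := by
  filter_upwards [eventually_ne_atTop 0] with n hn
  exact (G.root_spec (freq_mem_stdSimplex c hn)).1.1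

theorem dimH_le_liminf {c : ℕ → Fin k} (hc : RarelySwitching c) :
    ((dimH (limitSet F c) : ℝ≥0∞) : EReal) ≤
      liminf (fun n : ℕ => ((root F (freq c n) : ℝ) : EReal)) atTop := by
  by_contra! h
  obtain ⟨t, ht, h⟩ := EReal.lt_iff_exists_real_btwn.1 h
  obtain ⟨s, hs, hst⟩ := EReal.lt_iff_exists_real_btwn.1 ht
  rw [EReal.coe_lt_coe_iff] at hst
  have hfreq : ∃ᶠ n in atTop, root F (freq c n) < s :=
    (frequently_lt_of_liminf_lt (by isBoundedDefault) hs).mono fun n hn => by exact_mod_cast hn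
  obtain ⟨n, hn, hn0⟩ := (hfreq.and_eventually (G.eventually_root_freq_nonneg c)).exists
  have ht0 : 0 ≤ t := by linarith
  obtain ⟨r, hr0, hr1, hr⟩ := G.eventually_partSum_le hc t (sub_pos.2 hst)
  have hZ : ∃ᶠ n in atTop, partSum F c n t ≤ 1 :=
    (hfreq.and_eventually hr).mono fun n hn =>
      (hn.2 (by linarith [hn.1])).trans (pow_le_one₀ hr0.le hr1.le)
  have hle := G.dimH_limitSet_le (s := ⟨t, ht0⟩) hZ
  have hle' : ((dimH (limitSet F c) : ℝ≥0∞) : EReal) ≤ t := EReal.coe_ennreal_le_coe_ennreal_iff.2 hle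
  exact absurd h (not_lt.2 hle')

theorem liminf_le_dimH {c : ℕ → Fin k} (hc : RarelySwitching c) :
    liminf (fun n : ℕ => ((root F (freq c n) : ℝ) : EReal)) atTop ≤
      ((dimH (limitSet F c) : ℝ≥0∞) : EReal) := by
  by_contra! h
  obtain ⟨s, hs, h⟩ := EReal.lt_iff_exists_real_btwn.1 h
  obtain ⟨t, hst, ht⟩ := EReal.lt_iff_exists_real_btwn.1 h
  rw [EReal.coe_lt_coe_iff] at hst
  have hs0 : 0 < s := by
    have := (EReal.coe_ennreal_nonneg _).trans_lt hs
    exact_mod_cast this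
  obtain ⟨r, hr1, hr⟩ := G.eventually_le_partSum hc s (sub_pos.2 hst)
  have hZ : ∀ᶠ n in atTop, 1 ≤ partSum F c n s := by
    filter_upwards [eventually_lt_of_lt_liminf ht, hr] with n h1 h2
    have h1' : t < root F (freq c n) := by exact_mod_cast h1
    exact (one_le_pow₀ hr1.le).trans (h2 (by linarith))
  obtain ⟨c₀, hc₀, hle⟩ := exists_pos_forall_le_of_eventually (G.partSum_pos c · s) hZ
  have hdim := G.le_dimH_limitSet (s := ⟨s, hs0.le⟩) hs0 hc₀ hle
  have hdim' : (s : EReal) ≤ ((dimH (limitSet F c) : ℝ≥0∞) : EReal) :=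
    EReal.coe_ennreal_le_coe_ennreal_iff.2 hdim
  exact absurd hs (not_lt.2 hdim')

theorem upperBoxDim_le_limsup {c : ℕ → Fin k} (hc : RarelySwitching c) :
    upperBoxDim (limitSet F c) ≤
      limsup (fun n : ℕ => ((root F (freq c n) : ℝ) : EReal)) atTop := by
  by_contra! h
  obtain ⟨t, ht, h⟩ := EReal.lt_iff_exists_real_btwn.1 h
  obtain ⟨s, hs, hst⟩ := EReal.lt_iff_exists_real_btwn.1 ht
  -- The margin s - s' makes Z_n(s) summable; the margin t - s absorbs the constant in the covering
  -- bound.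
  obtain ⟨s', hs', hss⟩ := EReal.lt_iff_exists_real_btwn.1 hs
  rw [EReal.coe_lt_coe_iff] at hst hss
  have hev : ∀ᶠ n in atTop, root F (freq c n) < s' :=
    (eventually_lt_of_limsup_lt hs').mono fun n hn => by exact_mod_cast hn
  obtain ⟨n, hn, hn0⟩ := (hev.and (G.eventually_root_freq_nonneg c)).exists
  obtain ⟨r, hr0, hr1, hr⟩ := G.eventually_partSum_le hc s (sub_pos.2 hss)
  have hsum : Summable fun n => partSum F c n s := by
    refine (summable_geometric_of_lt_one hr0.le hr1).of_norm_bounded_eventually_nat ?_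
    filter_upwards [hev, hr] with n h1 h2
    rw [Real.norm_of_nonneg (G.partSum_pos c n s).le]
    exact h2 (by linarith)
  exact absurd h (not_lt.2 (G.upperBoxDim_limitSet_le (by linarith) hst hsum))

theorem limsup_le_upperBoxDim {c : ℕ → Fin k} (hc : RarelySwitching c) :
    limsup (fun n : ℕ => ((root F (freq c n) : ℝ) : EReal)) atTop ≤
      upperBoxDim (limitSet F c) := by
  by_contra! h
  obtain ⟨t, ht, h⟩ := EReal.lt_iff_exists_real_btwn.1 h
  obtain ⟨s, hts, h⟩ := EReal.lt_iff_exists_real_btwn.1 h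
  obtain ⟨s', hss, h⟩ := EReal.lt_iff_exists_real_btwn.1 h
  rw [EReal.coe_lt_coe_iff] at hts hss
  have ht0 : 0 < t := by
    have := (upperBoxDim_nonneg (G.limitSet_nonempty c)).trans_lt ht
    exact_mod_cast this
  obtain ⟨r, hr1, hr⟩ := G.eventually_le_partSum hc s (sub_pos.2 hss)
  obtain ⟨K, hK⟩ := G.exists_partSum_le_of_covering_le (by linarith) hts
    (eventually_covering_le_of_upperBoxDim_lt ht)
  -- Z_n(s) ≤ K holds for all large n, so exponential growth along infinitely many n already
  -- contradicts it; this is why the limsup appears.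
  obtain ⟨n, h1, h2, h3, h4⟩ := ((frequently_lt_of_lt_limsup (by isBoundedDefault) h).and_eventually
    (hr.and (hK.and ((tendsto_pow_atTop_atTop_of_one_lt hr1).eventually_gt_atTop K)))).exists
  have h1' : s' < root F (freq c n) := by exact_mod_cast h1
  have := h2 (by linarith)
  linarith

end Geometry

end CookieCutter

theorem mainTheorem4 {a b : ℝ} (hab : a < b) {τ : ℝ≥0} (hτ : 0 < τ) {k : ℕ}
    (F : Fin k → CookieCutter a b τ) (c : ℕ → Fin k) (hc : RarelySwitching c) :
    -- the pressure functions are well defined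
    (∀ j s, Tendsto (fun n : ℕ => (F j).pressureN n s) atTop (𝓝 ((F j).pressure s))) ∧
    -- `Root` is well defined on the simplex, takes values in `[0, 1]`, and is continuous
    (∀ α ∈ stdSimplex ℝ (Fin k), CookieCutter.root F α ∈ Icc (0 : ℝ) 1 ∧
      ∀ s : ℝ, ∑ j, α j * (F j).pressure s = 0 ↔ s = CookieCutter.root F α) ∧
    ContinuousOn (CookieCutter.root F) (stdSimplex ℝ (Fin k)) ∧
    -- the dimension formulae
    ((dimH (CookieCutter.limitSet F c) : ℝ≥0∞) : EReal) =
      liminf (fun n : ℕ => ((CookieCutter.root F (freq c n) : ℝ) : EReal)) atTop ∧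
    upperBoxDim (CookieCutter.limitSet F c) =
      limsup (fun n : ℕ => ((CookieCutter.root F (freq c n) : ℝ) : EReal)) atTop := by
  obtain ⟨G⟩ := CookieCutter.exists_geometry F hab hτ
  exact ⟨fun j s => (G.pressure_spec j s).1,
    fun α hα => ⟨(G.root_spec hα).1, G.sum_pressure_eq_zero_iff hα⟩,
    G.continuousOn_root,
    le_antisymm (G.dimH_le_liminf hc) (G.liminf_le_dimH hc),
    le_antisymm (G.upperBoxDim_le_limsup hc) (G.limsup_le_upperBoxDim hc)⟩
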